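/- **Theorem (Neural $\hat V$ approximation with expressivity, general form).** *Setting.* Let $N\in\mathbb N$, and for every dimension $D\ge 1$ consider problems of the following kind. Let $T>0$, $t_n=nT/N$ for $n=0,\dots,N$, let $(\Omega,\mathcal F,(\mathcal F_t)_{t\ge 0},\mathbb P)$ be a filtered probability space, $X$ an $\mathbb R^D$-valued process with $X_0=x_0\in\mathbb R^D$ a.s., and $g(t,x)$ a real payoff function. Norms are Euclidean. *Networks.* A ReLU network is $a_{I+1}\circ\sigma\circ a_I\circ\dots\circ\sigma\circ a_1$ with $I\ge 1$, affine maps $a_i$ and componentwise $\sigma(s)=\max(s,0)$; $I$ is its depth, and its size is the number of its non-zero weights and biases. For a function $h$ put $\mathrm{Growth}(h)=\sup_x\frac{\|h(x)\|}{1+\|x\|}$ and $\mathrm{Lip}(h)=\sup_{x\ne y}\frac{\|h(x)-h(y)\|}{\|x-y\|}$. An infinite-width network of depth $I\ge1$ has the same form with all hidden spaces equal to $\ell^2(\mathbb N)$. Its $i$-th layer is $y\mapsto w_0+\sum_{m\ge1}y_{m}w_m$ for $i=1$ (with $m\le D$) and $y\mapsto w_0+\sum_{m\ge 1}\sigma(y_{m-1})w_m$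 for $i\ge2$, with parameters $(w_m)_m$ of finite norm $\sum_m\|w_m\|$; its size is the (possibly infinite) number of non-zero entries of the $w_m$. A random network (RanNN) is an infinite-width network of fixed depth whose parameter is a Borel random variable on $\Omega$. *Assumptions.* Let $p>2$ and $c,q,r>0$ (not depending on $D$). (1) $X$ is adapted and Markovian along $(\mathcal F_{t_n})_{n=0}^N$, and for $n=0,\dots,N-1$ there are $\mathcal B(\mathbb R^D)\otimes\mathcal F_{t_{n+1}}$-measurable maps $f_n:\mathbb R^D\times\Omega\to\mathbb R^D$ such that - $X_{t_{n+1}}=f_n(X_{t_n},\cdot)$ a.s.; - $f_n(x,\cdot)$ is independent of $\mathcal F_{t_n}$ for each $x$; - $\mathbb E[X_{t_{n+1}}|\mathcal F_{t_n}]=\mathbb E[X_{t_{n+1}}|X_{t_n}]=\mathbb E[f_n(x,\cdot)]|_{x=X_{t_n}}$ a.s.; - $(\mathbb E|\mathrm{Growth}(f_n(*,\cdot))|^p)^{1/p}\le cD^q$; - there is a RanNN $\hat f_n$ of depth at most $cD^q$ with $\mathbb E[\mathrm{size}(\hat f_n)]\le cD^q$ such that, for a.e. $\omega$, $f_n(x,\omega)=\hat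 f_n(x,\omega)$ for all $x$. (2) For every $\varepsilon>0$ and $n=0,\dots,N$ there is a ReLU network $\hat g_n:\mathbb R^D\to\mathbb R$ with $|\hat g_n(x)-g(t_n,x)|\le\varepsilon cD^q(1+\|x\|)$ for all $x$, $\mathrm{size}(\hat g_n)\le cD^q\varepsilon^{-r}$ and $\mathrm{Lip}(\hat g_n)\le cD^q$; moreover $|g(t_n,0)|\le cD^q$. *Value function.* $V_n(x)=\sup_\tau\mathbb E[g(\tau,X^{n,x}_\tau)]$, where $\tau$ runs through the stopping times with values in $\{t_n,\dots,t_N\}$, $X^{n,x}_{t_n}=x$ and $X^{n,x}_{t_{m+1}}=f_m(X^{n,x}_{t_m},\cdot)$ for $m\ge n$. *Claim.* Let $\bar p\in(2,p]$, $k_1,p_1\in[1,\infty)$, and $k_{n+1}=c(1+k_n)$, $p_{n+1}=p_n+q$ for $n=1,\dots,N-1$. Then there are constants $c_{n+1},q_{n+1},\tau_{n+1}\in[1,\infty)$, $n=0,\dots,N-1$, depending only on $N,p,\bar p,c,q,r,k_1,p_1$ (in particular not on $D$), such that for every $D\ge1$, every problem as above that satisfies (1) and (2), every family of Borel probability measures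 $\rho_{n+1}$, $n=0,\dots,N-1$, on $\mathbb R^D$ with $$\Big(\int_{\mathbb R^D}\|z\|^{\bar p}\,d\rho_{n+1}\Big)^{1/\bar p}\le k_{n+1}D^{p_{n+1}},$$ and every $\varepsilon>0$, there are ReLU networks $\hat V_{n+1}:\mathbb R^D\to\mathbb R$, $n=0,\dots,N-1$, with $$\Big(\int_{\mathbb R^D}(V_{n+1}(z)-\hat V_{n+1}(z))^2\,d\rho_{n+1}\Big)^{1/2}\le\varepsilon,$$ $$\mathrm{size}(\hat V_{n+1})\le c_{n+1}D^{q_{n+1}}\varepsilon^{-\tau_{n+1}},\qquad \mathrm{Growth}(\hat V_{n+1})\le c_{n+1}D^{q_{n+1}}\varepsilon^{-\tau_{n+1}}.$$ -/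

import Mathlib

open MeasureTheory ProbabilityTheory
open scoped NNReal ENNReal

noncomputable section

namespace DeepMart

/-- `ℝ^d` with its Euclidean norm. -/
abbrev Vec (d : ℕ) : Type := EuclideanSpace ℝ (Fin d)

/-! ### Growth and Lipschitz constants -/

/-- `Growth(h) = sup_x ‖h(x)‖ / (1 + ‖x‖)`, with values in `[0, ∞]`. -/
def growth {E F : Type*} [NormedAddCommGroup E] [NormedAddCommGroup F] (h : E → F) : ℝ≥0∞ :=
  ⨆ x : E, ‖h x‖ₑ / (1 + ‖x‖ₑ)

/-- `Lip(h) = sup_{x ≠ y} ‖h(x) - h(y)‖ / ‖x - y‖`, with values in `[0, ∞]`. -/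
def lipConst {E F : Type*} [NormedAddCommGroup E] [NormedAddCommGroup F] (h : E → F) : ℝ≥0∞ :=
  ⨆ (x : E) (y : E) (_ : x ≠ y), ‖h x - h y‖ₑ / ‖x - y‖ₑ

/-! ### Finite ReLU networks -/

/-- Parameters of a feed-forward network from `ℝ^m` to `ℝ^k`: `output A b` is the last affine map
`x ↦ A x + b`; `hidden A b Φ` puts an affine map followed by the componentwise ReLU before `Φ`. -/
inductive ReLUNet : ℕ → ℕ → Type
  | output {m k : ℕ} (A : Matrix (Fin k) (Fin m) ℝ) (b : Fin k → ℝ) : ReLUNet m k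
  | hidden {m l k : ℕ} (A : Matrix (Fin l) (Fin m) ℝ) (b : Fin l → ℝ) (Φ : ReLUNet l k) :
      ReLUNet m k

/-- The number of non-zero entries of a weight matrix and a bias vector. -/
def affineSize {m k : ℕ} (A : Matrix (Fin k) (Fin m) ℝ) (b : Fin k → ℝ) : ℕ :=
  (Finset.univ.filter fun z : Fin k × Fin m => A z.1 z.2 ≠ 0).card +
    (Finset.univ.filter fun i : Fin k => b i ≠ 0).card

namespace ReLUNet

/-- The number of hidden layers. -/
def depth : {m k : ℕ} → ReLUNet m k → ℕ
  | _, _, output _ _ => 0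
  | _, _, hidden _ _ Φ => Φ.depth + 1

/-- The number of non-zero weights and biases. -/
def size : {m k : ℕ} → ReLUNet m k → ℕ
  | _, _, output A b => affineSize A b
  | _, _, hidden A b Φ => affineSize A b + Φ.size

/-- The function computed by the network. -/
def eval : {m k : ℕ} → ReLUNet m k → (Fin m → ℝ) → (Fin k → ℝ)
  | _, _, output A b, x => A.mulVec x + b
  | _, _, hidden A b Φ, x => Φ.eval (fun i => max ((A.mulVec x + b) i) 0)

/-- The real-valued function on `ℝ^d` computed by a network with one output node. -/
def toFun {d : ℕ} (Φ : ReLUNet d 1) (x : Vec d) : ℝ := Φ.eval (fun i => x i) 0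

end ReLUNet

/-! ### Infinite-width networks and random networks -/

/-- The square-summable real sequences. -/
abbrev Ell2 : Type := lp (fun _ : ℕ => ℝ) 2

/-- The `X`-valued measures `∑ m, w_m δ_m` on a countable discrete set `Θ`, with the total
variation norm `∑ m, ‖w_m‖`. -/
abbrev VecMeas (Θ X : Type) [NormedAddCommGroup X] : Type := lp (fun _ : Θ => X) 1

/-- Parameters of an infinite-width network `ℝ^d₁ → ℓ² → ⋯ → ℓ² → ℝ^d₃` with `L + 1` hidden layers,
with the product topology of the total variation norms. In every layer the atom at `0` is the
bias. -/
abbrev InfParams (d₁ d₃ L : ℕ) : Type :=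
  VecMeas (Fin (d₁ + 1)) Ell2 × (Fin L → VecMeas ℕ Ell2) × VecMeas ℕ (Vec d₃)

/-- First layer: `x ↦ w_0 + ∑_{m < d} x_m w_{m+1}`. -/
def inputLayer {d : ℕ} (w : VecMeas (Fin (d + 1)) Ell2) (x : Vec d) : Ell2 :=
  w 0 + ∑ m : Fin d, x m • w m.succ

/-- Later layers: `y ↦ w_0 + ∑_m σ(y_m) w_{m+1}` with `σ` the ReLU function. -/
def nextLayer {X : Type} [NormedAddCommGroup X] [NormedSpace ℝ X] (w : VecMeas ℕ X) (y : Ell2) :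
    X :=
  w 0 + ∑' m : ℕ, max (y m) 0 • w (m + 1)

/-- Composition of the layers between the hidden spaces `ℓ²`. -/
def hiddenLayers : (L : ℕ) → (Fin L → VecMeas ℕ Ell2) → Ell2 → Ell2
  | 0, _, y => y
  | L + 1, w, y => hiddenLayers L (fun i => w i.succ) (nextLayer (w 0) y)

/-- The function computed by an infinite-width network. -/
def infEval {d₁ d₃ L : ℕ} (θ : InfParams d₁ d₃ L) (x : Vec d₁) : Vec d₃ :=
  nextLayer θ.2.2 (hiddenLayers L θ.2.1 (inputLayer θ.1 x))

/-- The number (possibly infinite) of non-zero weights and biases of an infinite-width network. -/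
def infSize {d₁ d₃ L : ℕ} (θ : InfParams d₁ d₃ L) : ℕ∞ :=
  Set.encard {z : Fin (d₁ + 1) × ℕ | (θ.1 z.1 : ℕ → ℝ) z.2 ≠ 0} +
    ∑ i : Fin L, Set.encard {z : ℕ × ℕ | (θ.2.1 i z.1 : ℕ → ℝ) z.2 ≠ 0} +
    Set.encard {z : ℕ × Fin d₃ | (θ.2.2 z.1) z.2 ≠ 0}

/-- A random variable with values in the parameter space (with its Borel σ-algebra). -/
def IsRandomParam {Ω : Type*} (mΩ : MeasurableSpace Ω) {d₁ d₃ L : ℕ}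
    (θ : Ω → InfParams d₁ d₃ L) : Prop :=
  @Measurable Ω (InfParams d₁ d₃ L) mΩ (borel _) θ

/-! ### The optimal stopping problem -/

/-- The monitoring times `t_n = n T / N`. -/
def monitorTime (T : ℝ≥0) (N n : ℕ) : ℝ≥0 := n * T / N

/-- The process started at the value `x` at time `t_n` and moved by `X_{t_{m+1}} = f_m(X_{t_m}, ω)`,
observed at time `t_m` (only `m ≥ n` is meaningful). -/
def startedAt {Ω : Type*} {D : ℕ} (f : ℕ → Vec D → Ω → Vec D) (n : ℕ) (x : Vec D) :
    ℕ → Ω → Vec D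
  | 0, _ => x
  | m + 1, ω => if m < n then x else f m (startedAt f n x m ω) ω

/-- `τ` is the index of a stopping time with values in `{t_n, …, t_N}`. -/
def IsMonitorStopping {Ω : Type*} {mΩ : MeasurableSpace Ω} (𝓕 : Filtration ℝ≥0 mΩ) (T : ℝ≥0)
    (N n : ℕ) (τ : Ω → ℕ) : Prop :=
  (∀ ω, n ≤ τ ω ∧ τ ω ≤ N) ∧
    ∀ m, m ≤ N → MeasurableSet[𝓕 (monitorTime T N m)] {ω | τ ω ≤ m}

/-- The value function `V_n(x) = sup_τ E[g(τ, X_τ)]`, where `X` starts from `x` at time `t_n` and `τ`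
runs through the stopping times with values in `{t_n, …, t_N}`. -/
def valueFn {Ω : Type*} {mΩ : MeasurableSpace Ω} (P : Measure Ω) (𝓕 : Filtration ℝ≥0 mΩ) (T : ℝ≥0)
    (N : ℕ) {D : ℕ} (f : ℕ → Vec D → Ω → Vec D) (g : ℝ≥0 → Vec D → ℝ) (n : ℕ) (x : Vec D) : ℝ :=
  sSup {v : ℝ | ∃ τ : Ω → ℕ, IsMonitorStopping 𝓕 T N n τ ∧
    v = ∫ ω, g (monitorTime T N (τ ω)) (startedAt f n x (τ ω) ω) ∂P}

/-- `X` is adapted and Markovian along the monitoring times. -/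
def IsDiscreteMarkov {Ω : Type*} {mΩ : MeasurableSpace Ω} (P : Measure Ω) (𝓕 : Filtration ℝ≥0 mΩ)
    (T : ℝ≥0) (N : ℕ) {D : ℕ} (X : ℝ≥0 → Ω → Vec D) : Prop :=
  (∀ n, n ≤ N → Measurable[𝓕 (monitorTime T N n)] (X (monitorTime T N n))) ∧
    ∀ n, n < N → ∀ A : Set (Vec D), MeasurableSet A →
      P[(X (monitorTime T N (n + 1)) ⁻¹' A).indicator (fun _ => (1 : ℝ)) | 𝓕 (monitorTime T N n)]
        =ᵐ[P]
      P[(X (monitorTime T N (n + 1)) ⁻¹' A).indicator (fun _ => (1 : ℝ)) |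
        MeasurableSpace.comap (X (monitorTime T N n)) inferInstance]

/-- The `p`-dynamic process assumption with constants `c`, `q`, with the bound on the expected size
of the random networks, for the process `X` started at `x₀` and the one-step maps `f_n`. -/
structure DynamicAssumption {Ω : Type*} {mΩ : MeasurableSpace Ω} (P : Measure Ω)
    (𝓕 : Filtration ℝ≥0 mΩ) (T : ℝ≥0) (N : ℕ) {D : ℕ} (x₀ : Vec D) (X : ℝ≥0 → Ω → Vec D)
    (f : ℕ → Vec D → Ω → Vec D) (p c q : ℝ) : Prop where
  initial : ∀ᵐ ω ∂P, X (monitorTime T N 0) ω = x₀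
  markov : IsDiscreteMarkov P 𝓕 T N X
  measurable_step : ∀ n, n < N →
    Measurable[(inferInstance : MeasurableSpace (Vec D)).prod (𝓕 (monitorTime T N (n + 1)))]
      (fun z : Vec D × Ω => f n z.1 z.2)
  step : ∀ n, n < N → ∀ᵐ ω ∂P,
    X (monitorTime T N (n + 1)) ω = f n (X (monitorTime T N n) ω) ω
  indep : ∀ n, n < N → ∀ x : Vec D,
    Indep (MeasurableSpace.comap (f n x) inferInstance) (𝓕 (monitorTime T N n)) P
  condExp_eq : ∀ n, n < N →
    P[X (monitorTime T N (n + 1)) | 𝓕 (monitorTime T N n)] =ᵐ[P]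
      P[X (monitorTime T N (n + 1)) |
        MeasurableSpace.comap (X (monitorTime T N n)) inferInstance]
  condExp_eq_integral : ∀ n, n < N →
    P[X (monitorTime T N (n + 1)) |
        MeasurableSpace.comap (X (monitorTime T N n)) inferInstance] =ᵐ[P]
      fun ω => ∫ ω', f n (X (monitorTime T N n) ω) ω' ∂P
  growth_le : ∀ n, n < N →
    (∫⁻ ω, growth (fun x => f n x ω) ^ p ∂P) ^ (1 / p) ≤ ENNReal.ofReal (c * (D : ℝ) ^ q)
  ranNN : ∀ n, n < N → ∃ L : ℕ, ((L : ℝ) + 1) ≤ c * (D : ℝ) ^ q ∧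
    ∃ θ : Ω → InfParams D D L, IsRandomParam mΩ θ ∧
      (∀ᵐ ω ∂P, ∀ x, f n x ω = infEval (θ ω) x) ∧
      ∫⁻ ω, (infSize (θ ω) : ℝ≥0∞) ∂P ≤ ENNReal.ofReal (c * (D : ℝ) ^ q)

/-- The payoff approximation assumption with constants `c`, `q`, `r`. -/
def PayoffAssumption (T : ℝ≥0) (N : ℕ) {D : ℕ} (g : ℝ≥0 → Vec D → ℝ) (c q r : ℝ) : Prop :=
  ∀ ε : ℝ, 0 < ε → ∀ n, n ≤ N → ∃ Φ : ReLUNet D 1, 1 ≤ Φ.depth ∧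
    (∀ x, |Φ.toFun x - g (monitorTime T N n) x| ≤ ε * c * (D : ℝ) ^ q * (1 + ‖x‖)) ∧
    (Φ.size : ℝ) ≤ c * (D : ℝ) ^ q * ε ^ (-r) ∧
    lipConst Φ.toFun ≤ ENNReal.ofReal (c * (D : ℝ) ^ q) ∧
    |g (monitorTime T N n) 0| ≤ c * (D : ℝ) ^ q

end DeepMart

end

/-! The values satisfy `V_N = g(t_N, ·)` and `V_n(x) = max(g(t_n, x), E[V_{n+1}(f_n(x, ·))])`. Sums,
compositions and maxima of ReLU networks are again networks, at a cost linear in their sizes. Only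
two things have to be approximated: the payoff, which is covered by assumption, and the expectation.

The expectation is replaced by a Monte Carlo mean. If a network `Φ` approximates `V_{n+1}`, then the
average of `Φ (f_n(·, ω_i))` over `K` samples is a network, because almost every realization of
`f_n` is a finite network (`hasNet_infEval`). Its mean squared error in `L²(ρ)` is of order `1 / K`,
with a factor that involves only growth constants and second moments. The probabilistic method
provides one deterministic sample whose error, total size and total growth are all controlled
(`IsStep.exists_sample`, `IsStep.exists_net_stepMean`).

Jensen's inequality turns the error of `Φ` into an `L²` error under the law after one step from `ρ`
(`IsStep.eLpNorm_stepMean_sub_le`). The backward induction therefore runs over statements about all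
laws with polynomially bounded second moments (`HasValueNets`, `HasValueNets.exists_pred`). Every
bound is a monomial in `s = D / ε`, and this form survives `N` steps.

The recursion is optimal stopping theory (`IsChain.sSup_eq_snell`): the recursion values form a
supermartingale along the chain, and the first time at which the payoff reaches them is optimal. The
Markov property needs care, since `f_n(x, ·)` is independent of the past only for each fixed `x`.
Almost sure continuity in `x`, again a consequence of the networks, allows the substitution of a
past random point (`map_restrict_eq_map_prod`).

Finally, `ε ^ (-τ)` is small for large `ε`. The zero network serves once `ε` exceeds a bound of the
`L²` norm of the value, and `monomial_min_le` covers the remaining range. -/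

namespace DeepMart

/-! ### Calculus of finite ReLU networks -/

/-- `h` is computed by a ReLU network with `d` hidden layers and at most `s` non-zero parameters. -/
def HasNet {m k : ℕ} (d s : ℕ) (h : (Fin m → ℝ) → (Fin k → ℝ)) : Prop :=
  ∃ Φ : ReLUNet m k, Φ.depth = d ∧ Φ.size ≤ s ∧ Φ.eval = h

/-- The indicator of the non-zero reals, with values in `ℕ`. -/
noncomputable def nz (a : ℝ) : ℕ := if a = 0 then 0 else 1

@[simp] lemma nz_zero : nz 0 = 0 := by simp [nz]

@[simp] lemma nz_neg (a : ℝ) : nz (-a) = nz a := by simp [nz]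

lemma nz_le_one (a : ℝ) : nz a ≤ 1 := by unfold nz; split_ifs <;> simp

lemma nz_add_le (a b : ℝ) : nz (a + b) ≤ nz a + nz b := by
  unfold nz; split_ifs <;> simp_all

lemma nz_mul_le (a b : ℝ) : nz (a * b) ≤ nz b := by
  unfold nz; split_ifs <;> simp_all

/-- The number of non-zero entries of a vector. -/
noncomputable def vecSize {k : ℕ} (b : Fin k → ℝ) : ℕ := ∑ i, nz (b i)

/-- The number of non-zero entries of a matrix. -/
noncomputable def matSize {m k : ℕ} (A : Matrix (Fin k) (Fin m) ℝ) : ℕ := ∑ i, ∑ j, nz (A i j)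

lemma affineSize_eq {m k : ℕ} (A : Matrix (Fin k) (Fin m) ℝ) (b : Fin k → ℝ) :
    affineSize A b = matSize A + vecSize b := by
  unfold affineSize matSize vecSize nz
  rw [Finset.card_filter, Finset.card_filter, Fintype.sum_prod_type]
  simp only [ne_eq, ite_not]

/-- Two matrices side by side. -/
def hcat {m n k : ℕ} (A : Matrix (Fin k) (Fin m) ℝ) (B : Matrix (Fin k) (Fin n) ℝ) :
    Matrix (Fin k) (Fin (m + n)) ℝ := Matrix.of fun i => Fin.append (A i) (B i)

/-- Two matrices on top of each other. -/
def vcat {m k l : ℕ} (A : Matrix (Fin k) (Fin m) ℝ) (B : Matrix (Fin l) (Fin m) ℝ) :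
    Matrix (Fin (k + l)) (Fin m) ℝ :=
  Matrix.of fun i j => Fin.append (fun a => A a j) (fun a => B a j) i

lemma hcat_mulVec {m n k : ℕ} (A : Matrix (Fin k) (Fin m) ℝ) (B : Matrix (Fin k) (Fin n) ℝ)
    (x : Fin m → ℝ) (y : Fin n → ℝ) :
    (hcat A B).mulVec (Fin.append x y) = A.mulVec x + B.mulVec y := by
  funext i
  simp [hcat, Matrix.mulVec, dotProduct, Fin.sum_univ_add]

lemma vcat_mulVec {m k l : ℕ} (A : Matrix (Fin k) (Fin m) ℝ) (B : Matrix (Fin l) (Fin m) ℝ)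
    (x : Fin m → ℝ) : (vcat A B).mulVec x = Fin.append (A.mulVec x) (B.mulVec x) := by
  funext i
  refine Fin.addCases (fun i => ?_) (fun i => ?_) i
  · rw [Fin.append_left]
    simp only [vcat, Matrix.mulVec, dotProduct, Matrix.of_apply, Fin.append_left]
  · rw [Fin.append_right]
    simp only [vcat, Matrix.mulVec, dotProduct, Matrix.of_apply, Fin.append_right]

lemma matSize_hcat {m n k : ℕ} (A : Matrix (Fin k) (Fin m) ℝ) (B : Matrix (Fin k) (Fin n) ℝ) :
    matSize (hcat A B) = matSize A + matSize B := by
  simp only [matSize, hcat, Fin.sum_univ_add, Matrix.of_apply, Fin.append_left, Fin.append_right,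
    Finset.sum_add_distrib]

lemma matSize_vcat {m k l : ℕ} (A : Matrix (Fin k) (Fin m) ℝ) (B : Matrix (Fin l) (Fin m) ℝ) :
    matSize (vcat A B) = matSize A + matSize B := by
  simp only [matSize, vcat, Fin.sum_univ_add, Matrix.of_apply, Fin.append_left, Fin.append_right]

lemma vecSize_append {k l : ℕ} (b : Fin k → ℝ) (b' : Fin l → ℝ) :
    vecSize (Fin.append b b') = vecSize b + vecSize b' := by
  simp only [vecSize, Fin.sum_univ_add, Fin.append_left, Fin.append_right]

@[simp] lemma matSize_neg {m k : ℕ} (A : Matrix (Fin k) (Fin m) ℝ) :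
    matSize (-A) = matSize A := by simp [matSize]

@[simp] lemma matSize_zero {m k : ℕ} : matSize (0 : Matrix (Fin k) (Fin m) ℝ) = 0 := by
  simp [matSize]

@[simp] lemma vecSize_neg {k : ℕ} (b : Fin k → ℝ) : vecSize (-b) = vecSize b := by simp [vecSize]

lemma matSize_add_le {m k : ℕ} (A B : Matrix (Fin k) (Fin m) ℝ) :
    matSize (A + B) ≤ matSize A + matSize B := by
  simp only [matSize, ← Finset.sum_add_distrib]
  exact Finset.sum_le_sum fun i _ => Finset.sum_le_sum fun j _ => nz_add_le _ _

lemma vecSize_add_le {k : ℕ} (a b : Fin k → ℝ) : vecSize (a + b) ≤ vecSize a + vecSize b := by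
  simp only [vecSize, ← Finset.sum_add_distrib]
  exact Finset.sum_le_sum fun i _ => nz_add_le _ _

lemma append_add {k l : ℕ} (a b : Fin k → ℝ) (a' b' : Fin l → ℝ) :
    Fin.append a a' + Fin.append b b' = Fin.append (a + b) (a' + b') := by
  funext i
  refine Fin.addCases (fun i => ?_) (fun i => ?_) i
  · simp only [Pi.add_apply, Fin.append_left]
  · simp only [Pi.add_apply, Fin.append_right]

lemma relu_append {k l : ℕ} (a : Fin k → ℝ) (b : Fin l → ℝ) :
    (fun i => max (Fin.append a b i) 0) =
      Fin.append (fun i => max (a i) 0) (fun i => max (b i) 0) := by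
  funext i
  refine Fin.addCases (fun i => ?_) (fun i => ?_) i
  · simp only [Fin.append_left]
  · simp only [Fin.append_right]

lemma HasNet.mono {m k d s s' : ℕ} {h : (Fin m → ℝ) → (Fin k → ℝ)} (H : HasNet d s h)
    (hs : s ≤ s') : HasNet d s' h := by
  obtain ⟨Φ, h1, h2, h3⟩ := H
  exact ⟨Φ, h1, h2.trans hs, h3⟩

lemma hasNet_const {m k : ℕ} (b : Fin k → ℝ) :
    HasNet 0 k (fun _ : Fin m → ℝ => b) := by
  refine ⟨.output 0 b, rfl, ?_, ?_⟩
  · rw [ReLUNet.size, affineSize_eq, vecSize]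
    simpa using Finset.sum_le_sum fun i (_ : i ∈ Finset.univ) => nz_le_one (b i)
  · funext x
    simp [ReLUNet.eval]

/-- A hidden layer of width zero costs no parameters, so the depth can be prescribed freely. This
serves empty sums and the case of large `ε`. -/
lemma hasNet_zero {m k : ℕ} (d : ℕ) : HasNet d 0 (fun _ : Fin m → ℝ => (0 : Fin k → ℝ)) := by
  suffices H : ∀ d m : ℕ, ∃ Φ : ReLUNet m k, Φ.depth = d ∧ Φ.size = 0 ∧ ∀ x, Φ.eval x = 0 by
    obtain ⟨Φ, h1, h2, h3⟩ := H d m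
    exact ⟨Φ, h1, h2.le, funext h3⟩
  intro d
  induction d with
  | zero =>
    intro m
    exact ⟨.output 0 0, rfl, by simp [ReLUNet.size, affineSize], by simp [ReLUNet.eval]⟩
  | succ d ih =>
    intro m
    obtain ⟨Φ, h1, h2, h3⟩ := ih 0
    exact ⟨.hidden 0 0 Φ, by simp [ReLUNet.depth, h1], by simp [ReLUNet.size, affineSize, h2],
      fun x => by simp only [ReLUNet.eval, h3]⟩

/-- Only the last affine map is scaled, which creates no new non-zero entries. -/
lemma HasNet.smul {m k d s : ℕ} {h : (Fin m → ℝ) → (Fin k → ℝ)} (H : HasNet d s h) (a : ℝ) :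
    HasNet d s (fun x => a • h x) := by
  obtain ⟨Φ, h1, h2, h3⟩ := H
  suffices H : ∀ {m k : ℕ} (Φ : ReLUNet m k), ∃ Ψ : ReLUNet m k, Ψ.depth = Φ.depth ∧
      Ψ.size ≤ Φ.size ∧ ∀ x, Ψ.eval x = a • Φ.eval x by
    obtain ⟨Ψ, g1, g2, g3⟩ := H Φ
    exact ⟨Ψ, g1.trans h1, g2.trans h2, by funext x; rw [g3, h3]⟩
  intro m k Φ
  induction Φ with
  | output A b =>
    refine ⟨.output (a • A) (a • b), rfl, ?_, fun x => ?_⟩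
    · simp only [ReLUNet.size, affineSize_eq, matSize, vecSize, Matrix.smul_apply, Pi.smul_apply, smul_eq_mul]
      gcongr <;> exact nz_mul_le _ _
    · simp [ReLUNet.eval, Matrix.smul_mulVec]
  | hidden A b Φ ih =>
    obtain ⟨Ψ, g1, g2, g3⟩ := ih
    exact ⟨.hidden A b Ψ, by simp [ReLUNet.depth, g1], by simpa [ReLUNet.size] using g2,
      fun x => by simp only [ReLUNet.eval, g3]⟩

/-- Two networks of the same depth, run in parallel on separate inputs, with added outputs. -/
lemma exists_parallel {k : ℕ} : ∀ {m₁ m₂ : ℕ} (Φ : ReLUNet m₁ k) (Ψ : ReLUNet m₂ k),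
    Φ.depth = Ψ.depth → ∃ Θ : ReLUNet (m₁ + m₂) k, Θ.depth = Φ.depth ∧
      Θ.size ≤ Φ.size + Ψ.size ∧ ∀ x y, Θ.eval (Fin.append x y) = Φ.eval x + Ψ.eval y
  | _, _, .output A b, .output A' b', _ => by
    refine ⟨.output (hcat A A') (b + b'), rfl, ?_, fun x y => ?_⟩
    · simp only [ReLUNet.size, affineSize_eq, matSize_hcat]
      have := vecSize_add_le b b'
      omega
    · simp only [ReLUNet.eval, hcat_mulVec]
      abel
  | _, _, .hidden A b Φ, .hidden A' b' Ψ, h => by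
    obtain ⟨Θ, h1, h2, h3⟩ := exists_parallel Φ Ψ (by simpa [ReLUNet.depth] using h)
    refine ⟨.hidden (vcat (hcat A 0) (hcat 0 A')) (Fin.append b b') Θ,
      by simp [ReLUNet.depth, h1], ?_, fun x y => ?_⟩
    · simp only [ReLUNet.size, affineSize_eq, matSize_hcat, matSize_vcat, vecSize_append,
        matSize_zero]
      omega
    · simp only [ReLUNet.eval, vcat_mulVec, hcat_mulVec, append_add, relu_append, h3,
        Matrix.zero_mulVec, add_zero, zero_add]
  | _, _, .output _ _, .hidden _ _ _, h => by simp [ReLUNet.depth] at h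
  | _, _, .hidden _ _ _, .output _ _, h => by simp [ReLUNet.depth] at h

/-- The first layers read the same input and are stacked; from then on the networks run in parallel
on disjoint coordinates. Hence the sizes add without a factor. -/
lemma HasNet.add {m k d s₁ s₂ : ℕ} {h₁ h₂ : (Fin m → ℝ) → (Fin k → ℝ)}
    (H₁ : HasNet d s₁ h₁) (H₂ : HasNet d s₂ h₂) : HasNet d (s₁ + s₂) (fun x => h₁ x + h₂ x) := by
  obtain ⟨Φ, hd, hs, rfl⟩ := H₁
  obtain ⟨Ψ, hd', hs', rfl⟩ := H₂
  subst hd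
  cases Φ with
  | output A b =>
    cases Ψ with
    | hidden => simp [ReLUNet.depth] at hd'
    | output A' b' =>
      refine ⟨.output (A + A') (b + b'), rfl, le_trans ?_ (Nat.add_le_add hs hs'), ?_⟩
      · simp only [ReLUNet.size, affineSize_eq]
        have := vecSize_add_le b b'
        have := matSize_add_le A A'
        omega
      · funext x
        simp only [ReLUNet.eval, Matrix.add_mulVec]
        abel
  | hidden A b Φ =>
    cases Ψ with
    | output => simp [ReLUNet.depth] at hd'
    | hidden A' b' Ψ =>
      obtain ⟨Θ, h1, h2, h3⟩ := exists_parallel Φ Ψ (by simpa [ReLUNet.depth] using hd'.symm)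
      refine ⟨.hidden (vcat A A') (Fin.append b b') Θ, by simp [ReLUNet.depth, h1],
        le_trans ?_ (Nat.add_le_add hs hs'), ?_⟩
      · simp only [ReLUNet.size, affineSize_eq, matSize_vcat, vecSize_append]
        omega
      · funext x
        simp only [ReLUNet.eval, vcat_mulVec, append_add, relu_append, h3]

lemma HasNet.sum {m k d : ℕ} {ι : Type*} (t : Finset ι) {s : ι → ℕ}
    {h : ι → (Fin m → ℝ) → (Fin k → ℝ)} (H : ∀ i ∈ t, HasNet d (s i) (h i)) :
    HasNet d (∑ i ∈ t, s i) (fun x => ∑ i ∈ t, h i x) := by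
  classical
  induction t using Finset.induction_on with
  | empty => simpa using hasNet_zero d
  | insert a t ha ih =>
    simp only [Finset.sum_insert ha]
    exact (H a (Finset.mem_insert_self _ _)).add
      (ih fun i hi => H i (Finset.mem_insert_of_mem hi))

/-- Precomposition with `(y, z) ↦ y - z`. -/
lemma exists_precomp_sub {l k : ℕ} (Φ : ReLUNet l k) : ∃ Ψ : ReLUNet (l + l) k,
    Ψ.depth = Φ.depth ∧ Ψ.size ≤ 2 * Φ.size ∧
      ∀ y z, Ψ.eval (Fin.append y z) = Φ.eval (y - z) := by
  cases Φ with
  | output A b =>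
    refine ⟨.output (hcat A (-A)) b, rfl, ?_, fun y z => ?_⟩
    · simp only [ReLUNet.size, affineSize_eq, matSize_hcat, matSize_neg]
      omega
    · simp only [ReLUNet.eval, hcat_mulVec, Matrix.neg_mulVec, ← sub_eq_add_neg, Matrix.mulVec_sub]
  | hidden A b Φ =>
    refine ⟨.hidden (hcat A (-A)) b Φ, rfl, ?_, fun y z => ?_⟩
    · simp only [ReLUNet.size, affineSize_eq, matSize_hcat, matSize_neg]
      omega
    · simp only [ReLUNet.eval, hcat_mulVec, Matrix.neg_mulVec, ← sub_eq_add_neg, Matrix.mulVec_sub]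

/-- Multiplying the two adjacent weight matrices could destroy sparsity. A ReLU layer is inserted
instead, by `y = σ(y) - σ(-y)`: the last layer of the inner and the first layer of the outer network
are duplicated with signs. This explains the factors `2` and the extra depth. -/
lemma HasNet.comp {m l k d₁ d₂ s₁ s₂ : ℕ} {h₁ : (Fin m → ℝ) → (Fin l → ℝ)}
    {h₂ : (Fin l → ℝ) → (Fin k → ℝ)} (H₂ : HasNet d₂ s₂ h₂) (H₁ : HasNet d₁ s₁ h₁) :
    HasNet (d₁ + d₂ + 1) (2 * s₁ + 2 * s₂) (fun x => h₂ (h₁ x)) := by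
  obtain ⟨Φ, hd, hs, rfl⟩ := H₂
  obtain ⟨Φ', e1, e2, e3⟩ := exists_precomp_sub Φ
  suffices H : ∀ {m : ℕ} (Ψ : ReLUNet m l), ∃ Θ : ReLUNet m k, Θ.depth = Ψ.depth + Φ.depth + 1 ∧
      Θ.size ≤ 2 * Ψ.size + Φ'.size ∧ ∀ x, Θ.eval x = Φ.eval (Ψ.eval x) by
    obtain ⟨Ψ, hd', hs', rfl⟩ := H₁
    obtain ⟨Θ, g1, g2, g3⟩ := H Ψ
    exact ⟨Θ, by omega, by omega, funext g3⟩
  clear H₁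
  intro m Ψ
  induction Ψ with
  | output A b =>
    refine ⟨.hidden (vcat A (-A)) (Fin.append b (-b)) Φ', by simp [ReLUNet.depth, e1],
      ?_, fun x => ?_⟩
    · simp only [ReLUNet.size, affineSize_eq, matSize_vcat, vecSize_append, matSize_neg,
        vecSize_neg]
      omega
    · simp only [ReLUNet.eval, vcat_mulVec, append_add, relu_append, e3, Matrix.neg_mulVec,
        ← neg_add]
      congr 1
      funext i
      exact max_zero_sub_max_neg_zero_eq_self _
  | hidden A b Ψ ih =>
    obtain ⟨Θ, g1, g2, g3⟩ := ih (h₁ := h₁) Φ hd hs Φ' e1 e2 e3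
    exact ⟨.hidden A b Θ, by simp [ReLUNet.depth, g1]; omega, by simp [ReLUNet.size]; omega,
      fun x => by simp only [ReLUNet.eval, g3]⟩

lemma hasNet_relu : HasNet 1 2 (fun (x : Fin 1 → ℝ) i => max (x i) 0) := by
  refine ⟨.hidden (1 : Matrix (Fin 1) (Fin 1) ℝ) 0 (.output 1 0), rfl, ?_, ?_⟩
  · simp [ReLUNet.size, affineSize_eq, matSize, vecSize, nz]
  · funext x i
    simp [ReLUNet.eval]

/-- The identity of `ℝ` as a network of prescribed depth. -/
lemma hasNet_id (d : ℕ) : HasNet (d + 1) (2 * d + 4) (fun x : Fin 1 → ℝ => x) := by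
  -- Positive and negative parts are fixed by ReLU, so they pass through identity layers unchanged
  -- and are subtracted at the end.
  have H : ∀ d : ℕ, ∃ Φ : ReLUNet 2 1, Φ.depth = d ∧ Φ.size = 2 * d + 2 ∧
      ∀ a b, 0 ≤ a → 0 ≤ b → Φ.eval ![a, b] = fun _ => a - b := by
    intro d
    induction d with
    | zero =>
      refine ⟨.output !![1, -1] 0, rfl, ?_, fun a b _ _ => ?_⟩
      · simp [ReLUNet.size, affineSize_eq, matSize, vecSize, nz]
      · funext i
        simp [ReLUNet.eval]
        ring
    | succ d ih =>
      obtain ⟨Φ, h1, h2, h3⟩ := ih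
      refine ⟨.hidden 1 0 Φ, by simp [ReLUNet.depth, h1], ?_, fun a b ha hb => ?_⟩
      · simp [ReLUNet.size, affineSize_eq, matSize, vecSize, nz, h2]
        omega
      · simp only [ReLUNet.eval]
        rw [← h3 a b ha hb]
        congr 1
        funext i
        fin_cases i <;> simp [ha, hb]
  obtain ⟨Φ, h1, h2, h3⟩ := H d
  refine ⟨.hidden !![1; -1] 0 Φ, by simp [ReLUNet.depth, h1], ?_, ?_⟩
  · simp [ReLUNet.size, affineSize_eq, matSize, vecSize, nz, h2]
    omega
  · funext x
    simp only [ReLUNet.eval]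
    have : (fun i => max ((Matrix.mulVec !![1; -1] x + 0) i) 0) =
        ![max (x 0) 0, max (-(x 0)) 0] := by
      funext i
      fin_cases i <;> simp [dotProduct]
    rw [this, h3 _ _ (le_max_right _ _) (le_max_right _ _)]
    funext i
    rw [max_zero_sub_max_neg_zero_eq_self, Subsingleton.elim i 0]

/-- A network is equivalent to one whose depth is at most its size. -/
lemma HasNet.exists_depth_le {m k d s : ℕ} {h : (Fin m → ℝ) → (Fin k → ℝ)} (H : HasNet d s h) :
    ∃ d' ≤ s, HasNet d' (s + k) h := by
  obtain ⟨Φ, -, hs, rfl⟩ := H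
  suffices H : ∃ Ψ : ReLUNet m k, Ψ.depth ≤ Φ.size ∧ Ψ.size ≤ Φ.size + k ∧ Ψ.eval = Φ.eval by
    obtain ⟨Ψ, h1, h2, h3⟩ := H
    exact ⟨Ψ.depth, h1.trans hs, Ψ, rfl, by omega, h3⟩
  clear hs
  induction Φ with
  | output A b => exact ⟨.output A b, by simp [ReLUNet.depth], by simp, rfl⟩
  | @hidden m l k A b Φ ih =>
    -- A layer without non-zero parameters makes the network constant, and a single bias vector
    -- replaces it. Any other layer contributes at least one to the size.
    rcases Nat.eq_zero_or_pos (affineSize A b) with h0 | h0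
    · obtain ⟨Ψ, h1, h2, h3⟩ := hasNet_const (m := m) (Φ.eval 0)
      refine ⟨Ψ, by omega, by omega, ?_⟩
      rw [h3]
      simp only [affineSize, Nat.add_eq_zero_iff, Finset.card_eq_zero, Finset.filter_eq_empty_iff,
        Finset.mem_univ, true_implies, not_not, Prod.forall] at h0
      have hA : A = 0 := by ext i j; exact h0.1 i j
      have hb : b = 0 := by ext i; exact h0.2 (x := i)
      funext x
      simp only [ReLUNet.eval, hA, hb]
      congr 1
      funext i
      simp
    · obtain ⟨Ψ, h1, h2, h3⟩ := ih
      exact ⟨.hidden A b Ψ, by simp only [ReLUNet.depth, ReLUNet.size]; omega,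
        by simp only [ReLUNet.size]; omega, by funext x; simp only [ReLUNet.eval, h3]⟩

/-- The maximum of two scalar networks. -/
lemma HasNet.max {m d₁ d₂ s₁ s₂ : ℕ} {h₁ h₂ : (Fin m → ℝ) → (Fin 1 → ℝ)}
    (H₁ : HasNet d₁ s₁ h₁) (H₂ : HasNet d₂ s₂ h₂) :
    ∃ d ≥ 1, HasNet d (50 * (s₁ + s₂ + 2)) (fun x i => Max.max (h₁ x i) (h₂ x i)) := by
  obtain ⟨e₁, he₁, K₁⟩ := H₁.exists_depth_le
  obtain ⟨e₂, he₂, K₂⟩ := H₂.exists_depth_le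
  -- Each network is padded by an identity that makes up for the depth of the other; depths are at
  -- most sizes, so the cost is linear. Then `max a b = σ(a - b) + b`, where `b` passes one more
  -- identity layer to match the depth of the ReLU.
  have L₁ := (hasNet_id e₂).comp K₁
  have L₂ := (hasNet_id e₁).comp K₂
  rw [show e₂ + (e₁ + 1) + 1 = e₁ + (e₂ + 1) + 1 by omega] at L₂
  have M₁ := hasNet_relu.comp (L₁.add (L₂.smul (-1)))
  have M₂ := (hasNet_id 0).comp L₂
  refine ⟨e₁ + (e₂ + 1) + 1 + 1 + 1, by omega, ?_⟩
  convert (M₁.add M₂).mono ?_ using 1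
  · funext x i
    simp only [Pi.add_apply, Pi.smul_apply, smul_eq_mul, neg_mul, one_mul]
    rcases le_total (h₁ x i) (h₂ x i) with h | h
    · rw [max_eq_right h, max_eq_right (by linarith)]; ring
    · rw [max_eq_left h, max_eq_left (by linarith)]; ring
  · omega

lemma ReLUNet.continuous_eval {m k : ℕ} (Φ : ReLUNet m k) : Continuous Φ.eval := by
  induction Φ with
  | output A b =>
    simp only [ReLUNet.eval]
    fun_prop
  | hidden A b Φ ih => exact ih.comp (by fun_prop)

lemma ReLUNet.continuous_toFun {d : ℕ} (Φ : ReLUNet d 1) : Continuous Φ.toFun := by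
  have := Φ.continuous_eval
  unfold ReLUNet.toFun
  fun_prop

/-! ### Infinite-width networks of finite size -/

lemma encard_filter_le {α β : Type*} [Fintype α] (p : α → Prop) [DecidablePred p] (S : Set β)
    (e : α → β) (he : Function.Injective e) (h : ∀ a, p a → e a ∈ S) :
    ((Finset.univ.filter p).card : ℕ∞) ≤ S.encard := by
  classical
  rw [← Set.encard_coe_eq_coe_finsetCard]
  refine (he.injOn.encard_image).symm.trans_le (Set.encard_le_encard ?_)
  rintro _ ⟨a, ha, rfl⟩
  exact h a (by simpa using ha)

/-- The layer with atoms `w`, cut off to `M` input nodes and a finite set of output nodes. -/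
lemma affineSize_le_encard {κ : Type*} {M k : ℕ} (w : ℕ → κ → ℝ) (e : Fin k → κ)
    (he : Function.Injective e) :
    (affineSize (Matrix.of fun (j : Fin k) (m : Fin M) => w (m + 1) (e j)) (fun j => w 0 (e j))
      : ℕ∞) ≤ Set.encard {z : ℕ × κ | w z.1 z.2 ≠ 0} := by
  classical
  have h1 := encard_filter_le
    (fun z : Fin k × Fin M => (Matrix.of fun (j : Fin k) (m : Fin M) => w (m + 1) (e j)) z.1 z.2 ≠ 0)
    ({z : ℕ × κ | w z.1 z.2 ≠ 0} ∩ {z | z.1 ≠ 0}) (fun z => (z.2 + 1, e z.1))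
    (by
      rintro ⟨a, b⟩ ⟨a', b'⟩ h
      simp only [Prod.mk.injEq, Nat.add_right_cancel_iff] at h
      exact Prod.ext (he h.2) (Fin.ext h.1))
    (fun z hz => ⟨hz, Nat.succ_ne_zero _⟩)
  have h2 := encard_filter_le (fun i : Fin k => w 0 (e i) ≠ 0)
    ({z : ℕ × κ | w z.1 z.2 ≠ 0} \ {z | z.1 ≠ 0}) (fun j => (0, e j))
    (fun a b h => he (Prod.ext_iff.1 h).2) (fun j hj => ⟨hj, by simp⟩)
  rw [← Set.encard_sdiff_add_encard_inter _ {z : ℕ × κ | z.1 ≠ 0}]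
  unfold affineSize
  push_cast
  rw [add_comm]
  exact add_le_add h2 h1

lemma affineSize_input_le_encard {d M : ℕ} (w : Fin (d + 1) → ℕ → ℝ) :
    (affineSize (Matrix.of fun (j : Fin M) (m : Fin d) => w m.succ j) (fun j => w 0 j)
      : ℕ∞) ≤ Set.encard {z : Fin (d + 1) × ℕ | w z.1 z.2 ≠ 0} := by
  classical
  have h1 := encard_filter_le
    (fun z : Fin M × Fin d => (Matrix.of fun (j : Fin M) (m : Fin d) => w m.succ j) z.1 z.2 ≠ 0)
    ({z : Fin (d + 1) × ℕ | w z.1 z.2 ≠ 0} ∩ {z | z.1 ≠ 0}) (fun z => (z.2.succ, z.1))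
    (by
      rintro ⟨a, b⟩ ⟨a', b'⟩ h
      simp only [Prod.mk.injEq, Fin.succ_inj] at h
      exact Prod.ext (Fin.ext h.2) h.1)
    (fun z hz => ⟨hz, Fin.succ_ne_zero _⟩)
  have h2 := encard_filter_le (fun i : Fin M => w 0 i ≠ 0)
    ({z : Fin (d + 1) × ℕ | w z.1 z.2 ≠ 0} \ {z | z.1 ≠ 0}) (fun j => (0, j))
    (fun a b h => Fin.ext (Prod.ext_iff.1 h).2) (fun j hj => ⟨hj, by simp⟩)
  rw [← Set.encard_sdiff_add_encard_inter _ {z : Fin (d + 1) × ℕ | z.1 ≠ 0}]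
  unfold affineSize
  push_cast
  rw [add_comm]
  exact add_le_add h2 h1

lemma nextLayer_eq_sum {X : Type} [NormedAddCommGroup X] [NormedSpace ℝ X] (w : VecMeas ℕ X)
    {M : ℕ} (hw : ∀ m, M < m → w m = 0) (y : Ell2) :
    nextLayer w y = w 0 + ∑ m : Fin M, max (y m) 0 • w (m + 1) := by
  unfold nextLayer
  rw [tsum_eq_sum (s := Finset.range M)
    (fun m hm => by
      rw [hw (m + 1) (by simpa [Nat.lt_succ_iff] using hm), smul_zero]),
    Finset.sum_range]

/-- Atoms vanish beyond `M`, so a layer reads only the first `M` coordinates of its input and the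
other nodes can be dropped, even if their weights are not zero. The argument of `Φ` is already
rectified: infinite-width layers apply ReLU to their input, `hidden` applies it to its output. -/
lemma exists_net_hiddenLayers {d : ℕ} (M : ℕ) : ∀ (L : ℕ) (w : Fin L → VecMeas ℕ Ell2)
    (v : VecMeas ℕ (Vec d)), (∀ i m, M < m → w i m = 0) → (∀ m, M < m → v m = 0) →
    ∃ Φ : ReLUNet M d, Φ.depth = L ∧
      (Φ.size : ℕ∞) ≤ ∑ i : Fin L, Set.encard {z : ℕ × ℕ | (w i z.1 : ℕ → ℝ) z.2 ≠ 0} +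
        Set.encard {z : ℕ × Fin d | (v z.1) z.2 ≠ 0} ∧
      ∀ (y : Ell2) (i : Fin d), Φ.eval (fun j => max (y j) 0) i =
        nextLayer v (hiddenLayers L w y) i := by
  intro L
  induction L with
  | zero =>
    intro w v hw hv
    refine ⟨.output (Matrix.of fun j m => v (m + 1) j) (fun j => v 0 j), rfl, ?_, fun y i => ?_⟩
    · simp only [Finset.univ_eq_empty, Finset.sum_empty, zero_add, ReLUNet.size]
      exact affineSize_le_encard (fun m j => v m j) id Function.injective_id
    · rw [hiddenLayers, nextLayer_eq_sum v hv]
      simp only [ReLUNet.eval, Pi.add_apply, Matrix.mulVec, dotProduct, Matrix.of_apply,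
        PiLp.add_apply, WithLp.ofLp_sum, Finset.sum_apply, PiLp.smul_apply, smul_eq_mul]
      rw [add_comm]
      simp only [mul_comm]
  | succ L ih =>
    intro w v hw hv
    obtain ⟨Φ, h1, h2, h3⟩ := ih (fun i => w i.succ) v (fun i => hw i.succ) hv
    refine ⟨.hidden (Matrix.of fun j m => (w 0 (m + 1) : ℕ → ℝ) j) (fun j => (w 0 0 : ℕ → ℝ) j) Φ,
      by simp [ReLUNet.depth, h1], ?_, fun y i => ?_⟩
    · simp only [ReLUNet.size]
      push_cast
      rw [Fin.sum_univ_succ, add_assoc]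
      exact add_le_add (affineSize_le_encard (fun m j => (w 0 m : ℕ → ℝ) j) (fun j : Fin M => (j : ℕ))
        Fin.val_injective) h2
    · rw [hiddenLayers, ← h3, nextLayer_eq_sum (w 0) (hw 0)]
      simp only [ReLUNet.eval]
      congr 1
      funext j
      simp only [Pi.add_apply, Matrix.mulVec, dotProduct, Matrix.of_apply, lp.coeFn_add,
        lp.coeFn_sum, Finset.sum_apply, lp.coeFn_smul, Pi.smul_apply, smul_eq_mul]
      rw [add_comm]
      simp only [mul_comm]

lemma exists_bound_of_finite {α : Type*} {S : Set α} (hS : S.Finite) (e : α → ℕ) :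
    ∃ M, ∀ z ∈ S, e z ≤ M := by
  obtain ⟨M, hM⟩ := (hS.image e).bddAbove
  exact ⟨M, fun z hz => hM ⟨z, hz, rfl⟩⟩

/-- An infinite-width network of finite size is a finite network. -/
lemma hasNet_infEval {d₁ d₃ L s : ℕ} (θ : InfParams d₁ d₃ L) (h : infSize θ ≤ s) :
    HasNet (L + 1) s (fun (x : Fin d₁ → ℝ) i => infEval θ (WithLp.toLp 2 x) i) := by
  have hfin : infSize θ < ⊤ := h.trans_lt (ENat.natCast_lt_top s)
  have f2 : ∀ i, Set.Finite {z : ℕ × ℕ | (θ.2.1 i z.1 : ℕ → ℝ) z.2 ≠ 0} := by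
    intro i
    refine Set.encard_lt_top_iff.1 (lt_of_le_of_lt ?_ hfin)
    unfold infSize
    refine le_trans ?_ le_self_add
    refine le_trans ?_ le_add_self
    exact Finset.single_le_sum
      (f := fun i => Set.encard {z : ℕ × ℕ | (θ.2.1 i z.1 : ℕ → ℝ) z.2 ≠ 0})
      (fun _ _ => zero_le) (Finset.mem_univ i)
  have f3 : Set.Finite {z : ℕ × Fin d₃ | (θ.2.2 z.1) z.2 ≠ 0} :=
    Set.encard_lt_top_iff.1 (lt_of_le_of_lt le_add_self hfin)
  obtain ⟨M3, h3⟩ := exists_bound_of_finite f3 Prod.fst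
  choose M2 h2 using fun i => exists_bound_of_finite (f2 i) Prod.fst
  -- A common bound for the indices of the non-zero atoms in all layers after the input layer.
  set M := M3 + ∑ i, M2 i
  have hM2 : ∀ i, M2 i ≤ M := fun i =>
    (Finset.single_le_sum (f := M2) (fun _ _ => Nat.zero_le _) (Finset.mem_univ i)).trans
      (Nat.le_add_left _ _)
  obtain ⟨Φ, e1, e2, e3⟩ := exists_net_hiddenLayers M L θ.2.1 θ.2.2
    (by
      intro i m hm
      ext j
      by_contra hne
      exact absurd (h2 i (m, j) hne) (by have := hM2 i; simp only; omega))
    (by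
      intro m hm
      ext j
      by_contra hne
      exact absurd (h3 (m, j) hne) (by simp only; omega))
  refine ⟨.hidden (Matrix.of fun j m => (θ.1 m.succ : ℕ → ℝ) j) (fun j => (θ.1 0 : ℕ → ℝ) j) Φ,
    by simp [ReLUNet.depth, e1], ?_, ?_⟩
  · have : ((affineSize (Matrix.of fun (j : Fin M) (m : Fin d₁) => (θ.1 m.succ : ℕ → ℝ) j)
        (fun j => (θ.1 0 : ℕ → ℝ) j) + Φ.size : ℕ) : ℕ∞) ≤ (s : ℕ∞) := by
      push_cast
      refine le_trans ?_ h
      unfold infSize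
      rw [add_assoc]
      exact add_le_add (affineSize_input_le_encard fun m j => (θ.1 m : ℕ → ℝ) j) e2
    simp only [ReLUNet.size]
    exact_mod_cast this
  · funext x i
    unfold infEval
    rw [← e3]
    simp only [ReLUNet.eval]
    congr 1
    funext j
    simp only [inputLayer, Pi.add_apply, Matrix.mulVec, dotProduct, Matrix.of_apply, lp.coeFn_add,
      lp.coeFn_sum, Finset.sum_apply, lp.coeFn_smul, Pi.smul_apply, smul_eq_mul]
    rw [add_comm]
    simp only [mul_comm]

lemma HasNet.continuous {m k d s : ℕ} {h : (Fin m → ℝ) → (Fin k → ℝ)} (H : HasNet d s h) :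
    Continuous h := by
  obtain ⟨Φ, -, -, rfl⟩ := H
  exact Φ.continuous_eval

/-! ### Measurability of the size and of the growth constant -/

lemma encard_eq_tsum {α : Type*} (h : α → ℝ) :
    ((Set.encard {z | h z ≠ 0} : ℕ∞) : ℝ≥0∞) = ∑' z, if h z = 0 then 0 else 1 := by
  rw [← ENNReal.tsum_set_one, tsum_subtype {z | h z ≠ 0} fun _ => (1 : ℝ≥0∞)]
  refine tsum_congr fun z => ?_
  by_cases hz : h z = 0 <;> simp [hz]

lemma measurable_encard {Ω α : Type*} [MeasurableSpace Ω] [Countable α] {h : Ω → α → ℝ}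
    (hh : ∀ z, Measurable fun ω => h ω z) :
    Measurable fun ω => ((Set.encard {z | h ω z ≠ 0} : ℕ∞) : ℝ≥0∞) := by
  simp only [encard_eq_tsum]
  refine Measurable.tsum fun z => ?_
  exact Measurable.ite (hh z (measurableSet_singleton 0)) measurable_const measurable_const

/-- Coordinates are continuous on the parameter space, hence Borel, and the size is a countable sum
of indicators of non-zero coordinates. -/
lemma measurable_infSize {Ω : Type*} {mΩ : MeasurableSpace Ω} {d₁ d₃ L : ℕ}
    {θ : Ω → InfParams d₁ d₃ L} (hθ : IsRandomParam mΩ θ) :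
    Measurable fun ω => (infSize (θ ω) : ℝ≥0∞) := by
  have key : ∀ e : InfParams d₁ d₃ L → ℝ, Continuous e → Measurable fun ω => e (θ ω) := by
    intro e he
    borelize (InfParams d₁ d₃ L)
    exact he.measurable.comp hθ
  have hE : ∀ j : ℕ, Continuous fun y : Ell2 => y j := fun j =>
    (lp.evalCLM ℝ (fun _ : ℕ => ℝ) 2 j).continuous
  have h1 := measurable_encard (Ω := Ω) (α := Fin (d₁ + 1) × ℕ)
    (h := fun ω z => ((θ ω).1 z.1 : ℕ → ℝ) z.2)
    fun z => key (fun θ => (θ.1 z.1 : ℕ → ℝ) z.2) ((hE z.2).comp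
      ((lp.evalCLM ℝ (fun _ : Fin (d₁ + 1) => Ell2) 1 z.1).continuous.comp continuous_fst))
  have h2 : ∀ i : Fin L, _ := fun i => measurable_encard (Ω := Ω) (α := ℕ × ℕ)
    (h := fun ω z => ((θ ω).2.1 i z.1 : ℕ → ℝ) z.2)
    fun z => key (fun θ => (θ.2.1 i z.1 : ℕ → ℝ) z.2) ((hE z.2).comp
      ((lp.evalCLM ℝ (fun _ : ℕ => Ell2) 1 z.1).continuous.comp
        ((continuous_apply i).comp (continuous_fst.comp continuous_snd))))
  have h3 := measurable_encard (Ω := Ω) (α := ℕ × Fin d₃)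
    (h := fun ω z => ((θ ω).2.2 z.1) z.2)
    fun z => key (fun θ => (θ.2.2 z.1) z.2) ((EuclideanSpace.proj (𝕜 := ℝ) z.2).continuous.comp
      ((lp.evalCLM ℝ (fun _ : ℕ => Vec d₃) 1 z.1).continuous.comp
        (continuous_snd.comp continuous_snd)))
  have e : (fun ω => (infSize (θ ω) : ℝ≥0∞)) = fun ω =>
      ((Set.encard {z : Fin (d₁ + 1) × ℕ | ((θ ω).1 z.1 : ℕ → ℝ) z.2 ≠ 0} : ℕ∞) : ℝ≥0∞) +
      ∑ i : Fin L, ((Set.encard {z : ℕ × ℕ | ((θ ω).2.1 i z.1 : ℕ → ℝ) z.2 ≠ 0} : ℕ∞) : ℝ≥0∞) +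
      ((Set.encard {z : ℕ × Fin d₃ | ((θ ω).2.2 z.1) z.2 ≠ 0} : ℕ∞) : ℝ≥0∞) := by
    funext ω
    simp only [infSize, ENat.toENNReal_add]
    congr 2
    exact map_sum ENat.toENNRealRingHom _ _
  rw [e]
  exact (h1.add (Finset.measurable_sum _ fun i _ => h2 i)).add h3

lemma enorm_le_growth {E F : Type*} [NormedAddCommGroup E] [NormedAddCommGroup F] (h : E → F)
    (x : E) : ‖h x‖ₑ ≤ growth h * (1 + ‖x‖ₑ) := by
  have : ‖h x‖ₑ / (1 + ‖x‖ₑ) ≤ growth h := le_iSup (fun x => ‖h x‖ₑ / (1 + ‖x‖ₑ)) x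
  rwa [ENNReal.div_le_iff (by simp) (by simp)] at this

lemma growth_le_iff {E F : Type*} [NormedAddCommGroup E] [NormedAddCommGroup F] {h : E → F}
    {a : ℝ≥0∞} : growth h ≤ a ↔ ∀ x, ‖h x‖ₑ ≤ a * (1 + ‖x‖ₑ) := by
  unfold growth
  rw [iSup_le_iff]
  exact forall_congr' fun x => ENNReal.div_le_iff (by simp) (by simp)

/-- Continuity reduces an uncountable supremum to a countable one, which makes the growth constant
of a random map measurable up to a null set. -/
lemma growth_eq_iSup_denseSeq {E F : Type*} [NormedAddCommGroup E] [NormedAddCommGroup F]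
    [TopologicalSpace.SeparableSpace E] {h : E → F} (hh : Continuous h) :
    growth h = ⨆ i : ℕ, ‖h (TopologicalSpace.denseSeq E i)‖ₑ /
      (1 + ‖TopologicalSpace.denseSeq E i‖ₑ) := by
  refine le_antisymm ?_ (iSup_le fun i => le_iSup (fun x => ‖h x‖ₑ / (1 + ‖x‖ₑ)) _)
  refine iSup_le fun x => ?_
  set c := ⨆ i : ℕ, ‖h (TopologicalSpace.denseSeq E i)‖ₑ /
      (1 + ‖TopologicalSpace.denseSeq E i‖ₑ)
  have hc : Continuous fun x => ‖h x‖ₑ / (1 + ‖x‖ₑ) := by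
    refine continuous_iff_continuousAt.2 fun x => ?_
    exact ENNReal.Tendsto.div (hh.enorm.tendsto x) (Or.inr (by simp))
      ((continuous_const.add continuous_enorm).tendsto x) (Or.inr (by simp))
  have hcl : IsClosed {x | ‖h x‖ₑ / (1 + ‖x‖ₑ) ≤ c} := isClosed_le hc continuous_const
  have := (TopologicalSpace.denseRange_denseSeq E).closure_eq ▸
    closure_minimal (s := Set.range (TopologicalSpace.denseSeq E)) (by
      rintro _ ⟨i, rfl⟩
      exact le_iSup (fun i => ‖h (TopologicalSpace.denseSeq E i)‖ₑ /
        (1 + ‖TopologicalSpace.denseSeq E i‖ₑ)) i) hcl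
  exact this (Set.mem_univ x)

lemma aemeasurable_growth {Ω E F : Type*} [MeasurableSpace Ω] {P : Measure Ω}
    [NormedAddCommGroup E] [TopologicalSpace.SeparableSpace E] [NormedAddCommGroup F]
    [MeasurableSpace F] [OpensMeasurableSpace F] {f : E → Ω → F} (hf : ∀ x, Measurable (f x))
    (hc : ∀ᵐ ω ∂P, Continuous fun x => f x ω) :
    AEMeasurable (fun ω => growth fun x => f x ω) P := by
  refine ⟨fun ω => ⨆ i : ℕ, ‖f (TopologicalSpace.denseSeq E i) ω‖ₑ /
      (1 + ‖TopologicalSpace.denseSeq E i‖ₑ), ?_, ?_⟩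
  · exact Measurable.iSup fun i => (hf _).enorm.div_const _
  · filter_upwards [hc] with ω hω
    exact growth_eq_iSup_denseSeq hω

/-! ### Substituting a past random variable into an independent random map -/

section Substitution

variable {Ω E : Type*} {𝓖 mΩ : MeasurableSpace Ω} {P : Measure Ω} [IsProbabilityMeasure P]
  [NormedAddCommGroup E] [MeasurableSpace E] [BorelSpace E] [SecondCountableTopology E]

/-- On `{Y = y}` the random map is the fixed `f y`, and `A ∩ {Y = y}` belongs to `𝓖`, so each of
finitely many terms factorizes. -/
lemma setLIntegral_simpleFunc_of_indep (h𝓖 : 𝓖 ≤ mΩ) {f : E → Ω → E}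
    (hf : Measurable (Function.uncurry f))
    (hind : ∀ x, Indep (MeasurableSpace.comap (f x) inferInstance) 𝓖 P)
    (Y : @SimpleFunc Ω 𝓖 E) {A : Set Ω} (hA : MeasurableSet[𝓖] A) {φ : E → ℝ≥0∞}
    (hφ : Measurable φ) :
    ∫⁻ ω in A, φ (f (Y ω) ω) ∂P = ∫⁻ ω in A, ∫⁻ ω', φ (f (Y ω) ω') ∂P ∂P := by
  have hfx : ∀ x, Measurable (f x) := fun x => hf.comp measurable_prodMk_left
  have hY : ∀ y, MeasurableSet[𝓖] (A ∩ Y ⁻¹' {y}) := fun y =>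
    hA.inter (@SimpleFunc.measurableSet_fiber _ _ 𝓖 Y y)
  have key : ∀ g : E → Ω → ℝ≥0∞, (∀ y, Measurable (g y)) → ∫⁻ ω in A, g (Y ω) ω ∂P =
      ∑ y ∈ @SimpleFunc.range _ _ 𝓖 Y, ∫⁻ ω, (A ∩ Y ⁻¹' {y}).indicator 1 ω * g y ω ∂P := by
    intro g hg
    have hm : ∀ y, Measurable fun ω => (A ∩ Y ⁻¹' {y}).indicator 1 ω * g y ω := fun y =>
      (measurable_one.indicator (h𝓖 _ (hY y))).mul (hg y)
    rw [← lintegral_finsetSum _ fun y _ => hm y, ← lintegral_indicator (h𝓖 _ hA)]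
    refine lintegral_congr fun ω => ?_
    rw [Finset.sum_eq_single (Y ω)]
    · by_cases h : ω ∈ A <;> simp [h]
    · intro y _ hy
      rw [Set.indicator_of_notMem (fun h => hy h.2.symm), zero_mul]
    · exact fun h => absurd (@SimpleFunc.mem_range_self _ _ 𝓖 Y ω) h
  rw [key (fun y ω => φ (f y ω)) fun y => hφ.comp (hfx y),
    key (fun y _ => ∫⁻ ω', φ (f y ω') ∂P) fun y => measurable_const]
  refine Finset.sum_congr rfl fun y _ => ?_
  rw [lintegral_mul_const _ (measurable_one.indicator (h𝓖 _ (hY y)))]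
  refine lintegral_mul_eq_lintegral_mul_lintegral_of_independent_measurableSpace h𝓖
    (hfx y).comap_le (hind y).symm ?_ ?_
  · exact Measurable.indicator (m := 𝓖) (@measurable_const _ _ _ 𝓖 1) (hY y)
  · exact hφ.comp (comap_measurable (f y))

/-- Independence is available for each fixed `x` only, not for the random field as a whole. Simple
functions approximate `Y`, and almost sure continuity in `x` carries the identity to the limit. The
restriction to `A ∈ 𝓖` retains the conditional information. -/
lemma map_restrict_eq_map_prod (h𝓖 : 𝓖 ≤ mΩ) {f : E → Ω → E}
    (hf : Measurable (Function.uncurry f)) (hc : ∀ᵐ ω ∂P, Continuous fun x => f x ω)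
    (hind : ∀ x, Indep (MeasurableSpace.comap (f x) inferInstance) 𝓖 P)
    {Y : Ω → E} (hY : Measurable[𝓖] Y) {A : Set Ω} (hA : MeasurableSet[𝓖] A) :
    (P.restrict A).map (fun ω => f (Y ω) ω) =
      ((P.restrict A).prod P).map (fun z => f (Y z.1) z.2) := by
  have hY' : Measurable Y := hY.mono h𝓖 le_rfl
  have m1 : Measurable fun ω => f (Y ω) ω := hf.comp (hY'.prodMk measurable_id)
  have m2 : Measurable fun z : Ω × Ω => f (Y z.1) z.2 :=
    hf.comp ((hY'.comp measurable_fst).prodMk measurable_snd)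
  have hfx : ∀ x, Measurable (f x) := fun x => hf.comp measurable_prodMk_left
  -- Bounded continuous test functions determine a finite measure and permit dominated convergence
  -- on both sides.
  refine ext_of_forall_lintegral_eq_of_IsFiniteMeasure fun φ => ?_
  have hφc : Continuous fun x => (φ x : ℝ≥0∞) := ENNReal.continuous_coe.comp φ.continuous
  have hφ := hφc.measurable
  rw [lintegral_map hφ m1, lintegral_map hφ m2,
    lintegral_prod (fun z : Ω × Ω => (φ (f (Y z.1) z.2) : ℝ≥0∞)) (hφ.comp m2).aemeasurable]
  obtain ⟨C, hC⟩ : ∃ C : ℝ≥0, ∀ x, φ x ≤ C :=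
    ⟨_, BoundedContinuousFunction.NNReal.upper_bound φ⟩
  have hC' : ∀ x, (φ x : ℝ≥0∞) ≤ C := fun x => by exact_mod_cast hC x
  have hYs : StronglyMeasurable[𝓖] Y := hY.stronglyMeasurable
  set Yk := fun k => hYs.approx k
  have hYk : ∀ k, Measurable (Yk k) := fun k =>
    (@SimpleFunc.measurable _ _ 𝓖 _ (Yk k)).mono h𝓖 le_rfl
  have hH : Measurable fun x => ∫⁻ ω', (φ (f x ω') : ℝ≥0∞) ∂P :=
    (hφ.comp hf).lintegral_prod_right'
  have t1 : Filter.Tendsto (fun k => ∫⁻ ω in A, φ (f (Yk k ω) ω) ∂P) Filter.atTop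
      (nhds (∫⁻ ω in A, φ (f (Y ω) ω) ∂P)) := by
    refine tendsto_lintegral_of_dominated_convergence (fun _ => (C : ℝ≥0∞))
      (fun k => hφ.comp (hf.comp ((hYk k).prodMk measurable_id)))
      (fun k => Filter.Eventually.of_forall fun ω => hC' _) (by simp [ENNReal.mul_eq_top]) ?_
    filter_upwards [ae_restrict_of_ae hc] with ω hω
    exact ((hφc.comp hω).tendsto _).comp (hYs.tendsto_approx ω)
  have t2 : Filter.Tendsto (fun k => ∫⁻ ω in A, ∫⁻ ω', φ (f (Yk k ω) ω') ∂P ∂P) Filter.atTop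
      (nhds (∫⁻ ω in A, ∫⁻ ω', φ (f (Y ω) ω') ∂P ∂P)) := by
    refine tendsto_lintegral_of_dominated_convergence (fun _ => (C : ℝ≥0∞))
      (fun k => hH.comp (hYk k))
      (fun k => Filter.Eventually.of_forall fun ω => ?_) (by simp [ENNReal.mul_eq_top])
      (Filter.Eventually.of_forall fun ω => ?_)
    · exact (lintegral_mono fun ω' => hC' _).trans (by simp)
    · refine tendsto_lintegral_of_dominated_convergence (fun _ => (C : ℝ≥0∞))
        (fun k => hφ.comp (hfx _)) (fun k => Filter.Eventually.of_forall fun ω => hC' _)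
        (by simp) ?_
      filter_upwards [hc] with ω' hω'
      exact ((hφc.comp hω').tendsto _).comp (hYs.tendsto_approx ω)
  refine tendsto_nhds_unique t1 (t2.congr fun k => ?_)
  exact (setLIntegral_simpleFunc_of_indep h𝓖 hf hind (Yk k) hA hφ).symm

end Substitution

/-! ### One-step maps -/

/-- The properties of a one-step map that the approximation argument uses. -/
structure IsStep {Ω : Type*} [MeasurableSpace Ω] (P : Measure Ω) {D : ℕ} (f : Vec D → Ω → Vec D)
    (A : ℝ≥0) : Prop where
  measurable : Measurable (Function.uncurry f)
  continuous : ∀ᵐ ω ∂P, Continuous fun x => f x ω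
  moment : ∫⁻ ω, (1 + growth fun x => f x ω) ^ 2 ∂P ≤ A
  exists_nets : ∃ (L : ℕ) (S : Ω → ℝ≥0∞), Measurable S ∧ ∫⁻ ω, S ω ∂P ≤ A ∧
    ∀ᵐ ω ∂P, ∀ s : ℕ, S ω ≤ s → HasNet (L + 1) s fun (x : Fin D → ℝ) i => f (WithLp.toLp 2 x) ω i

section Step

variable {Ω : Type*} [MeasurableSpace Ω] {P : Measure Ω} {D : ℕ} {f : Vec D → Ω → Vec D} {A : ℝ≥0}

/-- With `1 + growth` in place of `growth`, the weight `1 + ‖x‖` propagates multiplicatively along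
the chain. -/
lemma one_add_enorm_le_growth (f : Vec D → Ω → Vec D) (x : Vec D) (ω : Ω) :
    1 + ‖f x ω‖ₑ ≤ (1 + growth fun x => f x ω) * (1 + ‖x‖ₑ) := by
  have h := enorm_le_growth (fun x => f x ω) x
  calc 1 + ‖f x ω‖ₑ ≤ (1 + ‖x‖ₑ) + (growth fun x => f x ω) * (1 + ‖x‖ₑ) :=
        add_le_add le_self_add h
    _ = _ := by ring

lemma IsStep.measurable_apply (hf : IsStep P f A) (x : Vec D) : Measurable (f x) :=
  hf.measurable.comp measurable_prodMk_left

lemma IsStep.lintegral_sq_le (hf : IsStep P f A) (x : Vec D) :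
    ∫⁻ ω, (1 + ‖f x ω‖ₑ) ^ 2 ∂P ≤ A * (1 + ‖x‖ₑ) ^ 2 := by
  calc ∫⁻ ω, (1 + ‖f x ω‖ₑ) ^ 2 ∂P
      ≤ ∫⁻ ω, (1 + growth fun x => f x ω) ^ 2 * (1 + ‖x‖ₑ) ^ 2 ∂P := by
        refine lintegral_mono fun ω => ?_
        rw [← mul_pow]
        exact pow_le_pow_left' (one_add_enorm_le_growth f x ω) 2
    _ = (∫⁻ ω, (1 + growth fun x => f x ω) ^ 2 ∂P) * (1 + ‖x‖ₑ) ^ 2 :=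
        lintegral_mul_const' _ _ (by simp)
    _ ≤ _ := by gcongr; exact hf.moment

lemma IsStep.lintegral_le (hf : IsStep P f A) (x : Vec D) :
    ∫⁻ ω, (1 + ‖f x ω‖ₑ) ∂P ≤ A * (1 + ‖x‖ₑ) := by
  calc ∫⁻ ω, (1 + ‖f x ω‖ₑ) ∂P
      ≤ ∫⁻ ω, (1 + growth fun x => f x ω) ^ 2 * (1 + ‖x‖ₑ) ∂P := by
        refine lintegral_mono fun ω => (one_add_enorm_le_growth f x ω).trans ?_
        gcongr
        exact le_self_pow le_self_add two_ne_zero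
    _ = (∫⁻ ω, (1 + growth fun x => f x ω) ^ 2 ∂P) * (1 + ‖x‖ₑ) :=
        lintegral_mul_const' _ _ (by simp)
    _ ≤ _ := by gcongr; exact hf.moment

/-- The expectation of a function of linear growth after one step. -/
noncomputable def stepMean (P : Measure Ω) (f : Vec D → Ω → Vec D) (U : Vec D → ℝ) (x : Vec D) : ℝ :=
  ∫ ω, U (f x ω) ∂P

lemma IsStep.measurable_stepMean [SFinite P] (hf : IsStep P f A) {U : Vec D → ℝ}
    (hU : Measurable U) : Measurable (stepMean P f U) :=
  (StronglyMeasurable.integral_prod_right (f := fun x ω => U (f x ω))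
    (hU.comp hf.measurable).stronglyMeasurable).measurable

lemma IsStep.integrable (hf : IsStep P f A) {U : Vec D → ℝ} (hU : Measurable U) {K : ℝ≥0}
    (hK : ∀ x, ‖U x‖ₑ ≤ K * (1 + ‖x‖ₑ)) (x : Vec D) : Integrable (fun ω => U (f x ω)) P := by
  refine ⟨(hU.comp (hf.measurable_apply x)).aestronglyMeasurable, ?_⟩
  refine lt_of_le_of_lt (lintegral_mono fun ω => hK _) ?_
  rw [lintegral_const_mul' _ _ (by simp)]
  exact ENNReal.mul_lt_top (by simp) ((hf.lintegral_le x).trans_lt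
    (ENNReal.mul_lt_top (by simp) (by simp)))

lemma IsStep.enorm_stepMean_le (hf : IsStep P f A) {U : Vec D → ℝ} {K : ℝ≥0}
    (hK : ∀ x, ‖U x‖ₑ ≤ K * (1 + ‖x‖ₑ)) (x : Vec D) :
    ‖stepMean P f U x‖ₑ ≤ (K * A : ℝ≥0) * (1 + ‖x‖ₑ) := by
  refine (enorm_integral_le_lintegral_enorm _).trans ?_
  refine (lintegral_mono fun ω => hK _).trans ?_
  rw [lintegral_const_mul' _ _ (by simp), ENNReal.coe_mul, mul_assoc]
  gcongr
  exact hf.lintegral_le x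

end Step

/-! ### Optimal stopping by backward recursion -/

section Snell

variable {Ω : Type*} {mΩ : MeasurableSpace Ω} {D : ℕ}

/-- The value of the stopping problem with payoffs `h` at `j` steps before the end `N`. -/
noncomputable def snellAux (P : Measure Ω) (f : ℕ → Vec D → Ω → Vec D) (h : ℕ → Vec D → ℝ) (N : ℕ) :
    ℕ → Vec D → ℝ
  | 0 => h N
  | j + 1 => fun x => max (h (N - (j + 1)) x)
      (stepMean P (f (N - (j + 1))) (snellAux P f h N j) x)

/-- The value of the stopping problem with payoffs `h` at time `n`, by backward recursion. -/
noncomputable def snell (P : Measure Ω) (f : ℕ → Vec D → Ω → Vec D) (h : ℕ → Vec D → ℝ) (N n : ℕ) :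
    Vec D → ℝ := snellAux P f h N (N - n)

/-- A Markov chain with steps `f` and payoffs `h`, in discrete time. -/
structure IsChain (P : Measure Ω) (𝓖 : ℕ → MeasurableSpace Ω) (N : ℕ) (f : ℕ → Vec D → Ω → Vec D)
    (h : ℕ → Vec D → ℝ) (A K : ℝ≥0) : Prop where
  le : ∀ m, 𝓖 m ≤ mΩ
  mono : Monotone 𝓖
  step : ∀ m, m < N → IsStep P (f m) A
  adapted : ∀ m, m < N →
    Measurable[(inferInstance : MeasurableSpace (Vec D)).prod (𝓖 (m + 1))] (Function.uncurry (f m))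
  indep : ∀ m, m < N → ∀ x, Indep (MeasurableSpace.comap (f m x) inferInstance) (𝓖 m) P
  payoff_measurable : ∀ m, m ≤ N → Measurable (h m)
  payoff_le : ∀ m, m ≤ N → ∀ x, ‖h m x‖ₑ ≤ K * (1 + ‖x‖ₑ)

variable {P : Measure Ω} {𝓖 : ℕ → MeasurableSpace Ω} {N : ℕ} {f : ℕ → Vec D → Ω → Vec D}
  {h : ℕ → Vec D → ℝ} {A K : ℝ≥0}

lemma snell_self (P : Measure Ω) (f : ℕ → Vec D → Ω → Vec D) (h : ℕ → Vec D → ℝ) (N : ℕ) :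
    snell P f h N N = h N := by simp [snell, snellAux]

lemma snell_of_lt (P : Measure Ω) (f : ℕ → Vec D → Ω → Vec D) (h : ℕ → Vec D → ℝ) {N n : ℕ}
    (hn : n < N) (x : Vec D) :
    snell P f h N n x = max (h n x) (stepMean P (f n) (snell P f h N (n + 1)) x) := by
  unfold snell
  rw [show N - n = (N - (n + 1)) + 1 by omega, snellAux]
  simp only
  rw [show N - (N - (n + 1) + 1) = n by omega]

lemma le_snell (P : Measure Ω) (f : ℕ → Vec D → Ω → Vec D) (h : ℕ → Vec D → ℝ) {N n : ℕ}
    (hn : n ≤ N) (x : Vec D) : h n x ≤ snell P f h N n x := by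
  rcases hn.eq_or_lt with rfl | hn
  · rw [snell_self]
  · rw [snell_of_lt P f h hn]
    exact le_max_left _ _

lemma IsChain.measurable_snell [SFinite P] (H : IsChain P 𝓖 N f h A K) {n : ℕ} (hn : n ≤ N) :
    Measurable (snell P f h N n) := by
  induction hn using Nat.decreasingInduction with
  | self => rw [snell_self]; exact H.payoff_measurable N le_rfl
  | of_succ n hn ih =>
    rw [show snell P f h N n = _ from funext fun x => snell_of_lt P f h hn x]
    exact (H.payoff_measurable n hn.le).max ((H.step n hn).measurable_stepMean ih)

/-- Each backward step multiplies the growth bound by at most `1 + A`. The exponent `N - n` is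
relaxed to `N`, so that one constant serves all times. -/
lemma IsChain.enorm_snell_le (H : IsChain P 𝓖 N f h A K) {n : ℕ} (hn : n ≤ N) (x : Vec D) :
    ‖snell P f h N n x‖ₑ ≤ (K * (1 + A) ^ N : ℝ≥0) * (1 + ‖x‖ₑ) := by
  suffices ∀ x, ‖snell P f h N n x‖ₑ ≤ (K * (1 + A) ^ (N - n) : ℝ≥0) * (1 + ‖x‖ₑ) by
    refine (this x).trans ?_
    gcongr
    · exact le_self_add
    · omega
  clear x
  induction hn using Nat.decreasingInduction with
  | self =>
    intro x
    rw [snell_self]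
    simpa using H.payoff_le N le_rfl x
  | of_succ n hn ih =>
    intro x
    rw [snell_of_lt P f h hn]
    have e1 := H.payoff_le n hn.le x
    have e2 := (H.step n hn).enorm_stepMean_le ih x
    have b1 : K ≤ K * (1 + A) ^ (N - n) := le_mul_of_one_le_right' (one_le_pow₀ le_self_add)
    have b2 : K * (1 + A) ^ (N - (n + 1)) * A ≤ K * (1 + A) ^ (N - n) := by
      rw [show N - n = (N - (n + 1)) + 1 by omega, pow_succ, mul_assoc]
      gcongr
      exact le_add_self
    rcases max_choice (h n x) (stepMean P (f n) (snell P f h N (n + 1)) x) with e | e <;> rw [e]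
    · exact e1.trans (by gcongr)
    · exact e2.trans (by gcongr)

/-! The process started at `x` at time `n`. -/

lemma startedAt_of_le (f : ℕ → Vec D → Ω → Vec D) {n m : ℕ} (x : Vec D) (hm : m ≤ n) (ω : Ω) :
    startedAt f n x m ω = x := by
  cases m with
  | zero => rfl
  | succ m => rw [startedAt, if_pos (by omega)]

lemma startedAt_succ (f : ℕ → Vec D → Ω → Vec D) {n m : ℕ} (x : Vec D) (hm : n ≤ m) (ω : Ω) :
    startedAt f n x (m + 1) ω = f m (startedAt f n x m ω) ω := by
  rw [startedAt, if_neg (by omega)]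

lemma IsChain.measurable_startedAt (H : IsChain P 𝓖 N f h A K) (n : ℕ) (x : Vec D) {m : ℕ}
    (hm : m ≤ N) : Measurable[𝓖 m] (startedAt f n x m) := by
  induction m with
  | zero =>
    rw [show startedAt f n x 0 = fun _ => x from rfl]
    exact measurable_const
  | succ m ih =>
    rcases le_or_gt n m with hnm | hnm
    · rw [show startedAt f n x (m + 1) = _ from funext fun ω => startedAt_succ f x hnm ω]
      have := (ih (by omega)).mono (H.mono (Nat.le_succ m)) le_rfl
      exact (H.adapted m (by omega)).comp
        (@Measurable.prodMk _ _ _ _ _ (𝓖 (m + 1)) _ _ this (@measurable_id _ (𝓖 (m + 1))))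
    · rw [show startedAt f n x (m + 1) = _ from
        funext fun ω => startedAt_of_le f x (by omega : m + 1 ≤ n) ω]
      exact measurable_const

lemma IsChain.map_startedAt [IsProbabilityMeasure P] (H : IsChain P 𝓖 N f h A K) {n m : ℕ}
    (x : Vec D) (hnm : n ≤ m) (hm : m < N) {B : Set Ω} (hB : MeasurableSet[𝓖 m] B) :
    (P.restrict B).map (startedAt f n x (m + 1)) =
      ((P.restrict B).prod P).map (fun z => f m (startedAt f n x m z.1) z.2) := by
  rw [← map_restrict_eq_map_prod (H.le m) (H.step m hm).measurable (H.step m hm).continuous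
    (H.indep m hm) (H.measurable_startedAt n x hm.le) hB]
  congr 1
  exact funext fun ω => startedAt_succ f x hnm ω

lemma IsChain.measurable_startedAt' (H : IsChain P 𝓖 N f h A K) (n : ℕ) (x : Vec D) {m : ℕ}
    (hm : m ≤ N) : Measurable (startedAt f n x m) :=
  (H.measurable_startedAt n x hm).mono (H.le m) le_rfl

lemma IsChain.measurable_pair (H : IsChain P 𝓖 N f h A K) (n : ℕ) (x : Vec D) {m : ℕ}
    (hm : m < N) : Measurable fun z : Ω × Ω => f m (startedAt f n x m z.1) z.2 :=
  (H.step m hm).measurable.comp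
    (((H.measurable_startedAt' n x hm.le).comp measurable_fst).prodMk measurable_snd)

lemma IsChain.lintegral_startedAt_lt_top [IsProbabilityMeasure P] (H : IsChain P 𝓖 N f h A K)
    {n m : ℕ} (x : Vec D) (hnm : n ≤ m) (hm : m ≤ N) :
    ∫⁻ ω, (1 + ‖startedAt f n x m ω‖ₑ) ∂P < ∞ := by
  induction m, hnm using Nat.le_induction with
  | base => simp [startedAt_of_le f x le_rfl]
  | succ m hnm ih =>
    have hφ : Measurable fun y : Vec D => 1 + ‖y‖ₑ := by fun_prop
    have e := H.map_startedAt x hnm (by omega) (B := Set.univ) (@MeasurableSet.univ _ (𝓖 m))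
    rw [Measure.restrict_univ] at e
    have hp := H.measurable_pair n x (by omega : m < N)
    rw [← lintegral_map hφ (H.measurable_startedAt' n x hm), e, lintegral_map hφ hp,
      lintegral_prod (fun z : Ω × Ω => 1 + ‖f m (startedAt f n x m z.1) z.2‖ₑ)
        (hφ.comp hp).aemeasurable]
    have hs := H.step m hm
    have hle : ∫⁻ ω, ∫⁻ ω', (1 + ‖f m (startedAt f n x m ω) ω'‖ₑ) ∂P ∂P ≤
        ∫⁻ ω, A * (1 + ‖startedAt f n x m ω‖ₑ) ∂P :=
      lintegral_mono fun ω => hs.lintegral_le (startedAt f n x m ω)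
    refine lt_of_le_of_lt hle ?_
    rw [lintegral_const_mul' _ _ ENNReal.coe_ne_top]
    exact ENNReal.mul_lt_top ENNReal.coe_lt_top (ih (Nat.le_of_succ_le hm))

lemma IsChain.integrable_comp [IsProbabilityMeasure P] (H : IsChain P 𝓖 N f h A K)
    {n m : ℕ} (x : Vec D) (hnm : n ≤ m) (hm : m ≤ N) {U : Vec D → ℝ} (hU : Measurable U) {C : ℝ≥0}
    (hC : ∀ x, ‖U x‖ₑ ≤ C * (1 + ‖x‖ₑ)) : Integrable (fun ω => U (startedAt f n x m ω)) P := by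
  refine ⟨(hU.comp (H.measurable_startedAt' n x hm)).aestronglyMeasurable, ?_⟩
  refine lt_of_le_of_lt (lintegral_mono fun ω => hC _) ?_
  rw [lintegral_const_mul' _ _ (by simp)]
  exact ENNReal.mul_lt_top (by simp) (H.lintegral_startedAt_lt_top x hnm hm)

/-- The Markov property. -/
lemma IsChain.setIntegral_succ [IsProbabilityMeasure P] (H : IsChain P 𝓖 N f h A K)
    {n m : ℕ} (x : Vec D) (hnm : n ≤ m) (hm : m < N) {B : Set Ω} (hB : MeasurableSet[𝓖 m] B)
    {U : Vec D → ℝ} (hU : Measurable U) {C : ℝ≥0} (hC : ∀ x, ‖U x‖ₑ ≤ C * (1 + ‖x‖ₑ)) :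
    ∫ ω in B, U (startedAt f n x (m + 1) ω) ∂P =
      ∫ ω in B, stepMean P (f m) U (startedAt f n x m ω) ∂P := by
  have e := H.map_startedAt x hnm hm hB
  have m1 := H.measurable_startedAt' n x (by omega : m + 1 ≤ N)
  have m2 := H.measurable_pair n x hm
  have i1 : Integrable U ((P.restrict B).map (startedAt f n x (m + 1))) := by
    rw [integrable_map_measure hU.aestronglyMeasurable m1.aemeasurable]
    exact (H.integrable_comp x (by omega) hm hU hC).restrict
  rw [← integral_map (f := U) m1.aemeasurable hU.aestronglyMeasurable, e,
    integral_map m2.aemeasurable hU.aestronglyMeasurable,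
    integral_prod (fun z : Ω × Ω => U (f m (startedAt f n x m z.1) z.2))]
  · rfl
  · rw [e] at i1
    exact (integrable_map_measure hU.aestronglyMeasurable m2.aemeasurable).1 i1

lemma integrable_stopped {Z : ℕ → Ω → ℝ} {n : ℕ} {τ : Ω → ℕ}
    (hτ : ∀ ω, n ≤ τ ω ∧ τ ω ≤ N) (hτm : Measurable τ)
    (hZ : ∀ m, n ≤ m → m ≤ N → Integrable (Z m) P) : Integrable (fun ω => Z (τ ω) ω) P := by
  have e : (fun ω => Z (τ ω) ω) =
      fun ω => ∑ m ∈ Finset.Icc n N, (τ ⁻¹' {m}).indicator (Z m) ω := by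
    funext ω
    rw [Finset.sum_eq_single (τ ω)]
    · simp
    · intro m _ hm
      exact Set.indicator_of_notMem (fun h => hm h.symm) _
    · exact fun hn => absurd (Finset.mem_Icc.2 (hτ ω)) hn
  rw [e]
  refine integrable_finsetSum _ fun m hm => ?_
  rw [Finset.mem_Icc] at hm
  exact (hZ m hm.1 hm.2).indicator (hτm (measurableSet_singleton m))

lemma measurable_of_stopping (h𝓖 : ∀ m, 𝓖 m ≤ mΩ) {τ : Ω → ℕ} (hτN : ∀ ω, τ ω ≤ N)
    (hτ : ∀ m, m ≤ N → MeasurableSet[𝓖 m] {ω | τ ω ≤ m}) : Measurable τ := by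
  refine measurable_of_Iic fun m => ?_
  rcases le_or_gt m N with hm | hm
  · exact h𝓖 m _ (hτ m hm)
  · convert MeasurableSet.univ
    exact Set.eq_univ_of_forall fun ω => (hτN ω).trans hm.le

/-- The expected value of the recursion at a stopping time, compared with its starting value. -/
lemma IsChain.integral_snell_stopped [IsProbabilityMeasure P] (H : IsChain P 𝓖 N f h A K)
    {n : ℕ} (x : Vec D) (hn : n ≤ N) {τ : Ω → ℕ} (hτb : ∀ ω, n ≤ τ ω ∧ τ ω ≤ N)
    (hτ : ∀ m, m ≤ N → MeasurableSet[𝓖 m] {ω | τ ω ≤ m}) :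
    ∫ ω, snell P f h N (τ ω) (startedAt f n x (τ ω) ω) ∂P ≤ snell P f h N n x ∧
    ((∀ ω m, n ≤ m → m < τ ω → h m (startedAt f n x m ω) <
        snell P f h N m (startedAt f n x m ω)) →
      ∫ ω, snell P f h N (τ ω) (startedAt f n x (τ ω) ω) ∂P = snell P f h N n x) := by
  -- `Z` is the Snell envelope along the chain; the proof telescopes this process stopped at `τ`.
  set Z : ℕ → Ω → ℝ := fun m ω => snell P f h N m (startedAt f n x m ω) with hZdef
  have hZ : ∀ m, n ≤ m → m ≤ N → Integrable (Z m) P := fun m h1 h2 =>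
    H.integrable_comp x h1 h2 (H.measurable_snell h2) (H.enorm_snell_le h2)
  have hτm := measurable_of_stopping H.le (fun ω => (hτb ω).2) hτ
  have hW : ∀ m, n ≤ m → Integrable (fun ω => Z (min (τ ω) m) ω) P := fun m hm =>
    integrable_stopped (n := n) (N := N) (τ := fun ω => min (τ ω) m)
      (fun ω => ⟨le_min (hτb ω).1 hm, (min_le_left _ _).trans (hτb ω).2⟩)
      (hτm.min measurable_const) hZ
  have hB : ∀ m, m ≤ N → MeasurableSet[𝓖 m] {ω | m < τ ω} := by
    intro m hm
    have := (hτ m hm).compl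
    convert this using 1
    ext ω
    simp
  -- The stopped process moves only on `{m < τ}`, an event of `𝓖 m`, so the Markov property replaces
  -- the next value by its one-step mean.
  have hstep : ∀ m, n ≤ m → m < N → ∫ ω, Z (min (τ ω) (m + 1)) ω ∂P =
      ∫ ω, Z (min (τ ω) m) ω ∂P +
        ∫ ω in {ω | m < τ ω}, (stepMean P (f m) (snell P f h N (m + 1)) (startedAt f n x m ω) -
          snell P f h N m (startedAt f n x m ω)) ∂P := by
    intro m h1 h2
    have hBm := H.le m _ (hB m h2.le)
    have i1 := hZ (m + 1) (by omega) h2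
    have i0 := hZ m h1 h2.le
    have i2 := H.integrable_comp x h1 h2.le
      ((H.step m h2).measurable_stepMean (H.measurable_snell h2))
      ((H.step m h2).enorm_stepMean_le (H.enorm_snell_le h2))
    have i3 : Integrable ({ω | m < τ ω}.indicator fun ω => Z (m + 1) ω - Z m ω) P :=
      (i1.sub i0).indicator hBm
    rw [integral_sub i2.restrict i0.restrict, ← H.setIntegral_succ x h1 h2 (hB m h2.le)
      (H.measurable_snell h2) (H.enorm_snell_le h2), ← integral_sub i1.restrict i0.restrict,
      ← integral_indicator hBm, ← integral_add (hW m h1) i3]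
    refine integral_congr_ae (Filter.Eventually.of_forall fun ω => ?_)
    simp only [Set.indicator_apply, Set.mem_ofPred_eq]
    by_cases hlt : m < τ ω
    · rw [if_pos hlt, min_eq_right (by omega), min_eq_right (by omega)]
      simp [hZdef]
    · rw [if_neg hlt, min_eq_left (by omega), min_eq_left (by omega), add_zero]
  have hstart : ∫ ω, Z (min (τ ω) n) ω ∂P = snell P f h N n x := by
    have : ∀ ω, Z (min (τ ω) n) ω = snell P f h N n x := by
      intro ω
      rw [min_eq_right (hτb ω).1]
      simp only [hZdef, startedAt_of_le f x le_rfl]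
    simp [this]
  have hend : ∫ ω, Z (min (τ ω) N) ω ∂P = ∫ ω, Z (τ ω) ω ∂P := by
    simp only [min_eq_left (hτb _).2]
  have hle : ∀ m, n ≤ m → m ≤ N → ∫ ω, Z (min (τ ω) m) ω ∂P ≤ snell P f h N n x := by
    intro m hm
    induction m, hm using Nat.le_induction with
    | base => exact fun _ => hstart.le
    | succ m hnm ih =>
      intro hmN
      rw [hstep m hnm hmN]
      have : ∫ ω in {ω | m < τ ω}, (stepMean P (f m) (snell P f h N (m + 1))
          (startedAt f n x m ω) - snell P f h N m (startedAt f n x m ω)) ∂P ≤ 0 := by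
        refine integral_nonpos fun ω => ?_
        simp only [Pi.zero_apply, sub_nonpos]
        rw [snell_of_lt P f h hmN]
        exact le_max_right _ _
      linarith [ih (by omega)]
  refine ⟨hend ▸ hle N hn le_rfl, fun hopt => ?_⟩
  -- Before `τ` the payoff lies strictly below the recursion value, so the maximum in the recursion
  -- is the continuation value and the drift vanishes.
  have heq : ∀ m, n ≤ m → m ≤ N → ∫ ω, Z (min (τ ω) m) ω ∂P = snell P f h N n x := by
    intro m hm
    induction m, hm using Nat.le_induction with
    | base => exact fun _ => hstart
    | succ m hnm ih =>
      intro hmN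
      rw [hstep m hnm hmN, ih (by omega)]
      rw [setIntegral_congr_fun (g := fun _ => (0 : ℝ)) (H.le m _ (hB m (by omega)))]
      · simp
      · intro ω hω
        have h1 := hopt ω m hnm hω
        simp only
        rw [snell_of_lt P f h hmN] at h1 ⊢
        rcases lt_max_iff.1 h1 with h2 | h2
        · exact absurd h2 (lt_irrefl _)
        · rw [max_eq_right h2.le, sub_self]
  rw [← heq N hn le_rfl, hend]

/-- The value function is given by the backward recursion. -/
lemma IsChain.sSup_eq_snell [IsProbabilityMeasure P] (H : IsChain P 𝓖 N f h A K)
    {n : ℕ} (x : Vec D) (hn : n ≤ N) :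
    sSup {v : ℝ | ∃ τ : Ω → ℕ, ((∀ ω, n ≤ τ ω ∧ τ ω ≤ N) ∧
      ∀ m, m ≤ N → MeasurableSet[𝓖 m] {ω | τ ω ≤ m}) ∧
      v = ∫ ω, h (τ ω) (startedAt f n x (τ ω) ω) ∂P} = snell P f h N n x := by
  classical
  -- The supremum is attained, so it is not a default value of `sSup`. The maximizer is the first `m
  -- ≥ n` at which the payoff reaches the recursion value; it exists because the two agree at `N`.
  refine IsGreatest.csSup_eq ⟨?_, ?_⟩
  · have hex : ∀ ω, ∃ m, n ≤ m ∧ snell P f h N m (startedAt f n x m ω) ≤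
        h m (startedAt f n x m ω) := fun ω => ⟨N, hn, by rw [snell_self]⟩
    have hfN : ∀ ω, Nat.find (hex ω) ≤ N := fun ω =>
      Nat.find_min' (hex ω) ⟨hn, by rw [snell_self]⟩
    have hb : ∀ ω, n ≤ Nat.find (hex ω) ∧ Nat.find (hex ω) ≤ N := fun ω =>
      ⟨(Nat.find_spec (hex ω)).1, hfN ω⟩
    have hst : ∀ m, m ≤ N → MeasurableSet[𝓖 m] {ω | Nat.find (hex ω) ≤ m} := by
      intro m hm
      have e : {ω | Nat.find (hex ω) ≤ m} = ⋃ j ∈ Finset.Icc n m,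
          {ω | snell P f h N j (startedAt f n x j ω) ≤ h j (startedAt f n x j ω)} := by
        ext ω
        simp only [Set.mem_ofPred_eq, Nat.find_le_iff, Set.mem_iUnion, Finset.mem_Icc, exists_prop]
        exact ⟨fun ⟨j, h1, h2, h3⟩ => ⟨j, ⟨h2, h1⟩, h3⟩, fun ⟨j, ⟨h2, h1⟩, h3⟩ => ⟨j, h1, h2, h3⟩⟩
      rw [e]
      refine Finset.measurableSet_biUnion _ fun j hj => ?_
      rw [Finset.mem_Icc] at hj
      have hjN : j ≤ N := hj.2.trans hm
      have hY := (H.measurable_startedAt n x hjN).mono (H.mono hj.2) le_rfl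
      exact measurableSet_le ((H.measurable_snell hjN).comp hY)
        ((H.payoff_measurable j hjN).comp hY)
    refine ⟨fun ω => Nat.find (hex ω), ⟨hb, hst⟩, ?_⟩
    rw [← (H.integral_snell_stopped x hn hb hst).2]
    · refine integral_congr_ae (Filter.Eventually.of_forall fun ω => ?_)
      exact le_antisymm (Nat.find_spec (hex ω)).2 (le_snell P f h (hfN ω) _)
    · intro ω m hm hlt
      have := Nat.find_min (hex ω) hlt
      by_contra hc
      exact this ⟨hm, not_lt.1 hc⟩
  · rintro v ⟨τ, ⟨hb, hst⟩, rfl⟩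
    refine le_trans ?_ (H.integral_snell_stopped x hn hb hst).1
    have hτm := measurable_of_stopping H.le (fun ω => (hb ω).2) hst
    refine integral_mono
      (integrable_stopped (Z := fun m ω => h m (startedAt f n x m ω)) hb hτm fun m h1 h2 =>
        H.integrable_comp x h1 h2 (H.payoff_measurable m h2) (H.payoff_le m h2))
      (integrable_stopped (Z := fun m ω => snell P f h N m (startedAt f n x m ω)) hb hτm
        fun m h1 h2 => H.integrable_comp x h1 h2 (H.measurable_snell h2) (H.enorm_snell_le h2))
      fun ω => le_snell P f h (hb ω).2 _

end Snell

/-! ### Monte Carlo approximation of one step -/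

section MonteCarlo

variable {Ω : Type*} [MeasurableSpace Ω] {P : Measure Ω} [IsProbabilityMeasure P]

lemma lintegral_enorm_sq_eq {α : Type*} [MeasurableSpace α] {μ : Measure α} {W : α → ℝ}
    (hW : MemLp W 2 μ) : ENNReal.ofReal (∫ ω, W ω ^ 2 ∂μ) = ∫⁻ ω, ‖W ω‖ₑ ^ 2 ∂μ := by
  rw [ofReal_integral_eq_lintegral_ofReal hW.integrable_sq
    (Filter.Eventually.of_forall fun ω => sq_nonneg _)]
  refine lintegral_congr fun ω => ?_
  rw [← sq_abs, ENNReal.ofReal_pow (abs_nonneg _), Real.enorm_eq_ofReal_abs]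

/-- The sample mean is unbiased, so its mean squared error is its variance, which is `Var[W] / K`
for independent coordinates. -/
lemma lintegral_monteCarlo_le {W : Ω → ℝ} (hW : MemLp W 2 P) {K : ℕ} (hK : 0 < K) :
    ∫⁻ ω : Fin K → Ω, ‖∫ a, W a ∂P - (K : ℝ)⁻¹ * ∑ i, W (ω i)‖ₑ ^ 2 ∂Measure.pi (fun _ => P) ≤
      (K : ℝ≥0∞)⁻¹ * ∫⁻ a, ‖W a‖ₑ ^ 2 ∂P := by
  have hK0 : (K : ℝ) ≠ 0 := by positivity
  set μ : Measure (Fin K → Ω) := Measure.pi (fun _ => P)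
  have hWi : ∀ i : Fin K, MemLp (fun ω : Fin K → Ω => W (ω i)) 2 μ := fun i =>
    hW.comp_measurePreserving (measurePreserving_eval (fun _ => P) i)
  have hX : MemLp (fun ω : Fin K → Ω => (K : ℝ)⁻¹ * ∑ i, W (ω i)) 2 μ :=
    (memLp_finsetSum _ fun i _ => hWi i).const_mul _
  have hmean : ∫ ω, (K : ℝ)⁻¹ * ∑ i, W (ω i) ∂μ = ∫ a, W a ∂P := by
    rw [integral_const_mul, integral_finsetSum _ fun i _ => (hWi i).integrable one_le_two]
    have : ∀ i : Fin K, ∫ ω, W (ω i) ∂μ = ∫ a, W a ∂P := fun i =>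
      integral_comp_eval (μ := fun _ : Fin K => P) (i := i) hW.aestronglyMeasurable
    simp only [this, Finset.sum_const, Finset.card_univ, Fintype.card_fin, nsmul_eq_mul]
    field_simp
  have hvar : Var[fun ω : Fin K → Ω => (K : ℝ)⁻¹ * ∑ i, W (ω i); μ] = (K : ℝ)⁻¹ * Var[W; P] := by
    have := variance_sum_pi (μ := fun _ : Fin K => P) (X := fun _ => W) fun _ => hW
    rw [show (∑ i, fun ω : Fin K → Ω => W (ω i)) = fun ω => ∑ i, W (ω i) by
      funext ω; simp] at this
    rw [variance_const_mul, this]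
    simp only [Finset.sum_const, Finset.card_univ, Fintype.card_fin, nsmul_eq_mul]
    field_simp
  have e1 : ∫⁻ ω : Fin K → Ω, ‖∫ a, W a ∂P - (K : ℝ)⁻¹ * ∑ i, W (ω i)‖ₑ ^ 2 ∂μ =
      evariance (fun ω : Fin K → Ω => (K : ℝ)⁻¹ * ∑ i, W (ω i)) μ := by
    unfold evariance
    rw [hmean]
    refine lintegral_congr fun ω => ?_
    rw [enorm_sub_rev]
  rw [e1, ← hX.ofReal_variance_eq, hvar, ENNReal.ofReal_mul (by positivity),
    ENNReal.ofReal_inv_of_pos (by positivity), ENNReal.ofReal_natCast, ← lintegral_enorm_sq_eq hW]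
  gcongr
  exact variance_le_expectation_sq hW.aestronglyMeasurable

/-- Divided by their bounds, the three quantities have a sum of mean at most `3`, and some point
outside the null set does not exceed this mean. Nonnegativity then bounds each summand. -/
lemma exists_le_three_mul {α : Type*} [MeasurableSpace α] {μ : Measure α} [IsProbabilityMeasure μ]
    {u v w : α → ℝ≥0∞} (hu : AEMeasurable u μ) (hv : AEMeasurable v μ) (hw : AEMeasurable w μ)
    {a b c : ℝ≥0} (ha : a ≠ 0) (hb : b ≠ 0) (hc : c ≠ 0) (hua : ∫⁻ x, u x ∂μ ≤ a)
    (hvb : ∫⁻ x, v x ∂μ ≤ b) (hwc : ∫⁻ x, w x ∂μ ≤ c) {p : α → Prop} (hp : ∀ᵐ x ∂μ, p x) :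
    ∃ x, p x ∧ u x ≤ 3 * a ∧ v x ≤ 3 * b ∧ w x ≤ 3 * c := by
  have ha' : (a : ℝ≥0∞) ≠ 0 := by exact_mod_cast ha
  have hb' : (b : ℝ≥0∞) ≠ 0 := by exact_mod_cast hb
  have hc' : (c : ℝ≥0∞) ≠ 0 := by exact_mod_cast hc
  obtain ⟨x, hx, hle⟩ := exists_notMem_null_le_lintegral
    (((hu.div_const a).add (hv.div_const b)).add (hw.div_const c)) (ae_iff.1 hp)
  have hint : ∫⁻ x, (u x / a + v x / b + w x / c) ∂μ ≤ 3 := by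
    have huv : AEMeasurable (fun x => u x / a + v x / b) μ := (hu.div_const _).add (hv.div_const _)
    rw [lintegral_add_left' huv, lintegral_add_left' (hu.div_const _)]
    simp only [div_eq_mul_inv]
    rw [lintegral_mul_const' _ _ (by simp [ha]), lintegral_mul_const' _ _ (by simp [hb]),
      lintegral_mul_const' _ _ (by simp [hc])]
    calc _ ≤ (a : ℝ≥0∞) * (a : ℝ≥0∞)⁻¹ + b * (b : ℝ≥0∞)⁻¹ + c * (c : ℝ≥0∞)⁻¹ := by gcongr
      _ = 3 := by
        rw [ENNReal.mul_inv_cancel ha' (by simp), ENNReal.mul_inv_cancel hb' (by simp),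
          ENNReal.mul_inv_cancel hc' (by simp)]
        norm_num
  have htot : u x / a + v x / b + w x / c ≤ 3 := hle.trans hint
  refine ⟨x, not_not.1 hx, ?_, ?_, ?_⟩
  · rw [← ENNReal.div_le_iff ha' (by simp)]
    exact (le_self_add.trans le_self_add).trans htot
  · rw [← ENNReal.div_le_iff hb' (by simp)]
    exact (le_add_self.trans le_self_add).trans htot
  · rw [← ENNReal.div_le_iff hc' (by simp)]
    exact le_add_self.trans htot

variable {D : ℕ} {f : Vec D → Ω → Vec D} {A : ℝ≥0}

lemma IsStep.memLp_two (hf : IsStep P f A) {φ : Vec D → ℝ} (hφ : Measurable φ) {γ : ℝ≥0}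
    (hγ : ∀ x, ‖φ x‖ₑ ≤ γ * (1 + ‖x‖ₑ)) (x : Vec D) : MemLp (fun ω => φ (f x ω)) 2 P := by
  refine ⟨(hφ.comp (hf.measurable_apply x)).aestronglyMeasurable, ?_⟩
  rw [eLpNorm_lt_top_iff_lintegral_rpow_enorm_lt_top two_ne_zero ENNReal.ofNat_ne_top]
  simp only [ENNReal.toReal_ofNat, ENNReal.rpow_ofNat]
  calc ∫⁻ ω, ‖φ (f x ω)‖ₑ ^ 2 ∂P ≤ ∫⁻ ω, γ ^ 2 * (1 + ‖f x ω‖ₑ) ^ 2 ∂P := by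
        refine lintegral_mono fun ω => ?_
        rw [← mul_pow]
        exact pow_le_pow_left' (hγ _) 2
    _ = γ ^ 2 * ∫⁻ ω, (1 + ‖f x ω‖ₑ) ^ 2 ∂P := lintegral_const_mul' _ _ (by finiteness)
    _ ≤ γ ^ 2 * (A * (1 + ‖x‖ₑ) ^ 2) := by gcongr; exact hf.lintegral_sq_le x
    _ < ∞ := by finiteness

lemma lintegral_sum_eval {K : ℕ} {S : Ω → ℝ≥0∞} (hS : AEMeasurable S P) {B : ℝ≥0}
    (hB : ∫⁻ ω, S ω ∂P ≤ B) :
    AEMeasurable (fun ω : Fin K → Ω => ∑ i, S (ω i)) (Measure.pi fun _ => P) ∧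
    ∫⁻ ω : Fin K → Ω, ∑ i, S (ω i) ∂Measure.pi (fun _ => P) ≤ (K * B : ℝ≥0) := by
  have hm : ∀ i : Fin K, AEMeasurable (fun ω : Fin K → Ω => S (ω i)) (Measure.pi fun _ => P) :=
    fun i => hS.comp_quasiMeasurePreserving
      (measurePreserving_eval (fun _ => P) i).quasiMeasurePreserving
  refine ⟨Finset.aemeasurable_fun_sum _ fun i _ => hm i, ?_⟩
  rw [lintegral_finsetSum' _ fun i _ => hm i]
  have : ∀ i : Fin K, ∫⁻ ω : Fin K → Ω, S (ω i) ∂Measure.pi (fun _ => P) ≤ B := by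
    intro i
    have e := (measurePreserving_eval (fun _ : Fin K => P) i).map_eq
    refine le_trans (le_of_eq ?_) hB
    rw [← lintegral_map' (f := S) (g := fun ω : Fin K → Ω => ω i)]
    · exact congrArg (fun μ => ∫⁻ a, S a ∂μ) e
    · exact e.symm ▸ hS
    · exact (measurable_pi_apply i).aemeasurable
  calc _ ≤ ∑ i : Fin K, (B : ℝ≥0∞) := Finset.sum_le_sum fun i _ => this i
    _ = _ := by simp

/-- A sample of the random map for which the Monte Carlo error, the sizes and the growth constants
are at most three times their means. -/
lemma IsStep.exists_sample (hf : IsStep P f A) (hA : A ≠ 0) {φ : Vec D → ℝ} (hφ : Measurable φ)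
    {γ : ℝ≥0} (hγ0 : γ ≠ 0) (hγ : ∀ x, ‖φ x‖ₑ ≤ γ * (1 + ‖x‖ₑ)) {ρ : Measure (Vec D)}
    [IsProbabilityMeasure ρ] {M : ℝ≥0} (hM0 : M ≠ 0) (hM : ∫⁻ z, (1 + ‖z‖ₑ) ^ 2 ∂ρ ≤ M)
    {K : ℕ} (hK : 0 < K) {S : Ω → ℝ≥0∞} (hS : AEMeasurable S P) (hSA : ∫⁻ ω, S ω ∂P ≤ A)
    {p : Ω → Prop} (hp : ∀ᵐ ω ∂P, p ω) :
    ∃ ω : Fin K → Ω, (∀ i, p (ω i)) ∧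
      ∫⁻ z, ‖stepMean P f φ z - (K : ℝ)⁻¹ * ∑ i, φ (f z (ω i))‖ₑ ^ 2 ∂ρ ≤
        3 * ((K : ℝ≥0)⁻¹ * (γ ^ 2 * (A * M)) : ℝ≥0) ∧
      ∑ i, S (ω i) ≤ 3 * ((K * A : ℝ≥0) : ℝ≥0∞) ∧
      ∑ i, (1 + growth fun x => f x (ω i)) ^ 2 ≤ 3 * ((K * A : ℝ≥0) : ℝ≥0∞) := by
  have hK0 : (K : ℝ≥0) ≠ 0 := by exact_mod_cast hK.ne'
  have hG : AEMeasurable (fun ω => (1 + growth fun x => f x ω) ^ 2) P :=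
    ((aemeasurable_growth (fun x => hf.measurable_apply x) hf.continuous).const_add 1).pow_const 2
  have hmeas : Measurable fun z : (Fin K → Ω) × Vec D =>
      ‖stepMean P f φ z.2 - (K : ℝ)⁻¹ * ∑ i, φ (f z.2 (z.1 i))‖ₑ ^ 2 := by
    refine Measurable.pow_const (Measurable.enorm ?_) 2
    refine ((hf.measurable_stepMean hφ).comp measurable_snd).sub (Measurable.const_mul ?_ _)
    exact Finset.measurable_sum _ fun i _ => hφ.comp (hf.measurable.comp
      (measurable_snd.prodMk ((measurable_pi_apply i).comp measurable_fst)))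
  have herr : ∫⁻ ω : Fin K → Ω, ∫⁻ z,
      ‖stepMean P f φ z - (K : ℝ)⁻¹ * ∑ i, φ (f z (ω i))‖ₑ ^ 2 ∂ρ ∂Measure.pi (fun _ => P) ≤
        ((K : ℝ≥0)⁻¹ * (γ ^ 2 * (A * M)) : ℝ≥0) := by
    -- After the exchange of integrals the Monte Carlo bound applies at each fixed `z`.
    rw [lintegral_lintegral_swap hmeas.aemeasurable]
    calc _ ≤ ∫⁻ z, (K : ℝ≥0∞)⁻¹ * (γ ^ 2 * (A * (1 + ‖z‖ₑ) ^ 2)) ∂ρ := by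
          refine lintegral_mono fun z => ?_
          refine (lintegral_monteCarlo_le (hf.memLp_two hφ hγ z) hK).trans ?_
          gcongr
          calc ∫⁻ ω, ‖φ (f z ω)‖ₑ ^ 2 ∂P ≤ ∫⁻ ω, γ ^ 2 * (1 + ‖f z ω‖ₑ) ^ 2 ∂P := by
                refine lintegral_mono fun ω => ?_
                rw [← mul_pow]
                exact pow_le_pow_left' (hγ _) 2
            _ = γ ^ 2 * ∫⁻ ω, (1 + ‖f z ω‖ₑ) ^ 2 ∂P := lintegral_const_mul' _ _ (by finiteness)
            _ ≤ γ ^ 2 * (A * (1 + ‖z‖ₑ) ^ 2) := by gcongr; exact hf.lintegral_sq_le z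
      _ = (K : ℝ≥0∞)⁻¹ * (γ ^ 2 * (A * ∫⁻ z, (1 + ‖z‖ₑ) ^ 2 ∂ρ)) := by
          rw [lintegral_const_mul' _ _ (by simp [hK.ne']), lintegral_const_mul' _ _ (by finiteness),
            lintegral_const_mul' _ _ (by finiteness)]
      _ ≤ (K : ℝ≥0∞)⁻¹ * (γ ^ 2 * (A * M)) := by gcongr
      _ = _ := by
          rw [ENNReal.coe_mul, ENNReal.coe_inv hK0]
          simp
  obtain ⟨hS1, hS2⟩ := lintegral_sum_eval (K := K) hS hSA
  obtain ⟨hG1, hG2⟩ := lintegral_sum_eval (K := K) hG hf.moment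
  refine exists_le_three_mul (μ := Measure.pi fun _ : Fin K => P)
    hmeas.lintegral_prod_right'.aemeasurable hS1 hG1
    (by positivity) (by positivity) (by positivity) herr hS2 hG2 ?_
  rw [ae_all_iff]
  exact fun i => (measurePreserving_eval (fun _ : Fin K => P) i).quasiMeasurePreserving.ae hp

end MonteCarlo

/-! ### Networks for one step of the recursion -/

lemma eLpNorm_two_sq {α : Type*} [MeasurableSpace α] {μ : Measure α} (u : α → ℝ) :
    eLpNorm u 2 μ ^ 2 = ∫⁻ x, ‖u x‖ₑ ^ 2 ∂μ := by
  rw [eLpNorm_eq_lintegral_rpow_enorm_toReal two_ne_zero ENNReal.ofNat_ne_top]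
  simp only [ENNReal.toReal_ofNat, ENNReal.rpow_ofNat]
  rw [← ENNReal.rpow_natCast, ← ENNReal.rpow_mul]
  norm_num

lemma eLpNorm_two_le {α : Type*} [MeasurableSpace α] {μ : Measure α} {u : α → ℝ} {a : ℝ≥0∞}
    (h : ∫⁻ x, ‖u x‖ₑ ^ 2 ∂μ ≤ a ^ 2) : eLpNorm u 2 μ ≤ a := by
  rw [← eLpNorm_two_sq] at h
  exact (ENNReal.pow_right_strictMono two_ne_zero).le_iff_le.1 h

section OneStep

variable {Ω : Type*} [MeasurableSpace Ω] {P : Measure Ω} [IsProbabilityMeasure P]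
  {D : ℕ} {f : Vec D → Ω → Vec D} {A : ℝ≥0}

/-- The law after one step from the initial law `ρ`. -/
noncomputable def stepLaw (P : Measure Ω) (f : Vec D → Ω → Vec D) (ρ : Measure (Vec D)) :
    Measure (Vec D) := (ρ.prod P).map (Function.uncurry f)

lemma IsStep.isProbabilityMeasure_stepLaw (hf : IsStep P f A) (ρ : Measure (Vec D))
    [IsProbabilityMeasure ρ] : IsProbabilityMeasure (stepLaw P f ρ) :=
  Measure.isProbabilityMeasure_map hf.measurable.aemeasurable

lemma IsStep.lintegral_stepLaw (hf : IsStep P f A) (ρ : Measure (Vec D))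
    [IsProbabilityMeasure ρ] {u : Vec D → ℝ≥0∞} (hu : Measurable u) :
    ∫⁻ z, u z ∂stepLaw P f ρ = ∫⁻ z, ∫⁻ ω, u (f z ω) ∂P ∂ρ := by
  rw [stepLaw, lintegral_map hu hf.measurable]
  exact lintegral_prod (fun z : Vec D × Ω => u (f z.1 z.2)) (hu.comp hf.measurable).aemeasurable

lemma IsStep.moment_stepLaw_le (hf : IsStep P f A) (ρ : Measure (Vec D))
    [IsProbabilityMeasure ρ] {M : ℝ≥0} (hM : ∫⁻ z, (1 + ‖z‖ₑ) ^ 2 ∂ρ ≤ M) :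
    ∫⁻ z, (1 + ‖z‖ₑ) ^ 2 ∂stepLaw P f ρ ≤ (A * M : ℝ≥0) := by
  rw [hf.lintegral_stepLaw ρ (by fun_prop)]
  calc _ ≤ ∫⁻ z, A * (1 + ‖z‖ₑ) ^ 2 ∂ρ := lintegral_mono fun z => hf.lintegral_sq_le z
    _ = A * ∫⁻ z, (1 + ‖z‖ₑ) ^ 2 ∂ρ := lintegral_const_mul' _ _ (by simp)
    _ ≤ A * M := by gcongr
    _ = _ := by simp

lemma enorm_integral_sq_le (u : Ω → ℝ) (hu : AEStronglyMeasurable u P) :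
    ‖∫ ω, u ω ∂P‖ₑ ^ 2 ≤ ∫⁻ ω, ‖u ω‖ₑ ^ 2 ∂P := by
  rw [← eLpNorm_two_sq]
  refine pow_le_pow_left' ((enorm_integral_le_lintegral_enorm _).trans ?_) 2
  rw [← eLpNorm_one_eq_lintegral_enorm]
  exact eLpNorm_le_eLpNorm_of_exponent_le one_le_two hu

lemma IsStep.eLpNorm_stepMean_sub_le (hf : IsStep P f A) (ρ : Measure (Vec D))
    [IsProbabilityMeasure ρ] {V φ : Vec D → ℝ} (hV : Measurable V) (hφ : Measurable φ) {C γ : ℝ≥0}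
    (hC : ∀ x, ‖V x‖ₑ ≤ C * (1 + ‖x‖ₑ)) (hγ : ∀ x, ‖φ x‖ₑ ≤ γ * (1 + ‖x‖ₑ)) :
    eLpNorm (fun z => stepMean P f V z - stepMean P f φ z) 2 ρ ≤
      eLpNorm (fun z => V z - φ z) 2 (stepLaw P f ρ) := by
  refine eLpNorm_two_le ?_
  rw [eLpNorm_two_sq, hf.lintegral_stepLaw ρ (u := fun z => ‖V z - φ z‖ₑ ^ 2) (by fun_prop)]
  refine lintegral_mono fun z => ?_
  unfold stepMean
  rw [← integral_sub (hf.integrable hV hC z) (hf.integrable hφ hγ z)]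
  exact enorm_integral_sq_le (fun ω => V (f z ω) - φ (f z ω))
    ((hV.sub hφ).comp (hf.measurable_apply z)).aestronglyMeasurable

lemma HasNet.exists_toFun {d s : ℕ} {h : (Fin D → ℝ) → (Fin 1 → ℝ)} (H : HasNet d s h) :
    ∃ Φ : ReLUNet D 1, Φ.depth = d ∧ Φ.size ≤ s ∧ ∀ x : Vec D, Φ.toFun x = h (fun i => x i) 0 := by
  obtain ⟨Φ, h1, h2, rfl⟩ := H
  exact ⟨Φ, h1, h2, fun x => rfl⟩

/-- The expectation of a network after one step is approximated by a network. -/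
lemma IsStep.exists_net_stepMean (hf : IsStep P f A) (hA : A ≠ 0) (ρ : Measure (Vec D))
    [IsProbabilityMeasure ρ] {M : ℝ≥0} (hM0 : M ≠ 0) (hM : ∫⁻ z, (1 + ‖z‖ₑ) ^ 2 ∂ρ ≤ M)
    (Φ : ReLUNet D 1) {γ : ℝ≥0} (hγ0 : γ ≠ 0) (hγ : growth Φ.toFun ≤ γ) {K : ℕ} (hK : 0 < K) :
    ∃ Ψ : ReLUNet D 1, (Ψ.size : ℝ) ≤ K * (6 * A + 2 + 2 * Φ.size) ∧
      growth Ψ.toFun ≤ (3 * A * γ : ℝ≥0) ∧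
      ∫⁻ z, ‖stepMean P f Φ.toFun z - Ψ.toFun z‖ₑ ^ 2 ∂ρ ≤
        3 * ((K : ℝ≥0)⁻¹ * (γ ^ 2 * (A * M)) : ℝ≥0) := by
  obtain ⟨L, S, hS, hSA, hnet⟩ := hf.exists_nets
  have hγ' := growth_le_iff.1 hγ
  obtain ⟨ω, hω, e1, e2, e3⟩ := hf.exists_sample hA Φ.continuous_toFun.measurable hγ0 hγ' hM0 hM hK
    hS.aemeasurable hSA hnet
  have hKr : (K : ℝ) ≠ 0 := by positivity
  have hSfin : ∀ i, S (ω i) ≠ ∞ := fun i => ne_top_of_le_ne_top (by finiteness)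
    ((Finset.single_le_sum (f := fun i => S (ω i)) (fun _ _ => zero_le)
      (Finset.mem_univ i)).trans e2)
  -- Rounding up to an integer costs at most one per sample, which yields the summand `2` in the
  -- size bound.
  set s : Fin K → ℕ := fun i => ⌈(S (ω i)).toReal⌉₊
  have hs : ∀ i, HasNet (L + 1) (s i) fun (x : Fin D → ℝ) j => f (WithLp.toLp 2 x) (ω i) j := by
    intro i
    refine hω i _ ?_
    rw [← ENNReal.ofReal_toReal (hSfin i), ← ENNReal.ofReal_natCast]
    exact ENNReal.ofReal_le_ofReal (Nat.le_ceil _)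
  have hΦ : HasNet Φ.depth Φ.size Φ.eval := ⟨Φ, rfl, le_rfl, rfl⟩
  -- All samples have the same depth `L + 1`, so their compositions with `Φ` can be added without
  -- padding.
  have hsum := (HasNet.sum Finset.univ fun i _ => hΦ.comp (hs i)).smul (K : ℝ)⁻¹
  obtain ⟨Ψ, -, h2, h3⟩ := hsum.exists_toFun
  have hΨ : ∀ z, Ψ.toFun z = (K : ℝ)⁻¹ * ∑ i, Φ.toFun (f z (ω i)) := by
    intro z
    rw [h3]
    simp only [Pi.smul_apply, Finset.sum_apply, smul_eq_mul, ReLUNet.toFun]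
  refine ⟨Ψ, ?_, ?_, ?_⟩
  · have h4 : (Ψ.size : ℝ) ≤ ∑ i, (2 * (s i : ℝ) + 2 * Φ.size) := by exact_mod_cast h2
    have h5 : ∀ i, (s i : ℝ) ≤ (S (ω i)).toReal + 1 := fun i =>
      (Nat.ceil_lt_add_one ENNReal.toReal_nonneg).le
    have h6 : ∑ i, (S (ω i)).toReal ≤ 3 * (K * A) := by
      rw [← ENNReal.toReal_sum fun i _ => hSfin i]
      refine (ENNReal.toReal_mono (by finiteness) e2).trans (le_of_eq ?_)
      simp
    calc (Ψ.size : ℝ) ≤ ∑ i, (2 * ((S (ω i)).toReal + 1) + 2 * Φ.size) := by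
          refine h4.trans (Finset.sum_le_sum fun i _ => ?_)
          linarith [h5 i]
      _ = 2 * ∑ i, (S (ω i)).toReal + K * (2 + 2 * Φ.size) := by
          rw [Finset.mul_sum]
          simp only [mul_add, Finset.sum_add_distrib, Finset.sum_const, Finset.card_univ,
            Fintype.card_fin, nsmul_eq_mul]
          ring
      _ ≤ _ := by linarith
  · rw [growth_le_iff]
    intro z
    rw [hΨ, enorm_mul]
    have hKe : ‖(K : ℝ)⁻¹‖ₑ = (K : ℝ≥0∞)⁻¹ := by
      rw [Real.enorm_eq_ofReal (by positivity), ENNReal.ofReal_inv_of_pos (by positivity),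
        ENNReal.ofReal_natCast]
    have hb : ‖∑ i, Φ.toFun (f z (ω i))‖ₑ ≤ γ * (3 * ((K * A : ℝ≥0) : ℝ≥0∞)) * (1 + ‖z‖ₑ) := by
      calc _ ≤ ∑ i, ‖Φ.toFun (f z (ω i))‖ₑ := enorm_sum_le _ _
        _ ≤ ∑ i, γ * (1 + growth fun x => f x (ω i)) ^ 2 * (1 + ‖z‖ₑ) := by
            refine Finset.sum_le_sum fun i _ => (hγ' _).trans ?_
            rw [mul_assoc]
            gcongr
            refine (one_add_enorm_le_growth f z (ω i)).trans ?_
            gcongr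
            exact le_self_pow le_self_add two_ne_zero
        _ = γ * (∑ i, (1 + growth fun x => f x (ω i)) ^ 2) * (1 + ‖z‖ₑ) := by
            rw [Finset.mul_sum, Finset.sum_mul]
        _ ≤ _ := by gcongr
    rw [hKe]
    calc (K : ℝ≥0∞)⁻¹ * ‖∑ i, Φ.toFun (f z (ω i))‖ₑ
        ≤ (K : ℝ≥0∞)⁻¹ * (γ * (3 * ((K * A : ℝ≥0) : ℝ≥0∞)) * (1 + ‖z‖ₑ)) := by gcongr
      _ = ((K : ℝ≥0∞)⁻¹ * K) * (3 * A * γ * (1 + ‖z‖ₑ)) := by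
          push_cast
          ring
      _ = _ := by
          rw [ENNReal.inv_mul_cancel (by exact_mod_cast hK.ne') (by simp), one_mul]
          simp
  · simp only [hΨ]
    exact e1

lemma enorm_max_sub_max_le (a b a' b' : ℝ) :
    ‖max a b - max a' b'‖ₑ ≤ ‖a - a'‖ₑ + ‖b - b'‖ₑ := by
  have h : |max a b - max a' b'| ≤ |a - a'| + |b - b'| :=
    (abs_max_sub_max_le_max a b a' b').trans (max_le_add_of_nonneg (abs_nonneg _) (abs_nonneg _))
  simp only [Real.enorm_eq_ofReal_abs]
  rw [← ENNReal.ofReal_add (abs_nonneg _) (abs_nonneg _)]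
  exact ENNReal.ofReal_le_ofReal h

lemma ReLUNet.exists_max (Φ Ψ : ReLUNet D 1) : ∃ Θ : ReLUNet D 1, 1 ≤ Θ.depth ∧
    Θ.size ≤ 50 * (Φ.size + Ψ.size + 2) ∧ ∀ x, Θ.toFun x = max (Φ.toFun x) (Ψ.toFun x) := by
  obtain ⟨d, hd, H⟩ := HasNet.max (⟨Φ, rfl, le_rfl, rfl⟩ : HasNet Φ.depth Φ.size Φ.eval)
    (⟨Ψ, rfl, le_rfl, rfl⟩ : HasNet Ψ.depth Ψ.size Ψ.eval)
  obtain ⟨Θ, h1, h2, h3⟩ := H.exists_toFun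
  exact ⟨Θ, h1 ▸ hd, h2, h3⟩

lemma growth_max_le {u v w : Vec D → ℝ} (h : ∀ x, w x = max (u x) (v x)) {a b : ℝ≥0}
    (hu : growth u ≤ a) (hv : growth v ≤ b) : growth w ≤ (a + b : ℝ≥0) := by
  rw [growth_le_iff] at *
  intro x
  rw [h]
  rcases max_choice (u x) (v x) with e | e <;> rw [e]
  · refine (hu x).trans ?_
    gcongr
    exact le_self_add
  · refine (hv x).trans ?_
    gcongr
    exact le_add_self

/-- One step of the backward recursion, with payoff `g` and value `V` at the next time. -/
lemma IsStep.exists_net_max (hf : IsStep P f A) (hA : A ≠ 0) (ρ : Measure (Vec D))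
    [IsProbabilityMeasure ρ] {M : ℝ≥0} (hM0 : M ≠ 0) (hM : ∫⁻ z, (1 + ‖z‖ₑ) ^ 2 ∂ρ ≤ M)
    {V g : Vec D → ℝ} (hV : Measurable V) (hg : Measurable g) {C : ℝ≥0}
    (hC : ∀ x, ‖V x‖ₑ ≤ C * (1 + ‖x‖ₑ)) (Φ Γ : ReLUNet D 1) {γ γ' : ℝ≥0} (hγ0 : γ ≠ 0)
    (hγ : growth Φ.toFun ≤ γ) (hγ' : growth Γ.toFun ≤ γ') {K : ℕ} (hK : 0 < K) {δ₁ δ₂ δ₃ : ℝ≥0}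
    (h₁ : eLpNorm (fun z => g z - Γ.toFun z) 2 ρ ≤ δ₁)
    (h₂ : eLpNorm (fun z => V z - Φ.toFun z) 2 (stepLaw P f ρ) ≤ δ₂)
    (h₃ : 3 * ((K : ℝ≥0)⁻¹ * (γ ^ 2 * (A * M))) ≤ δ₃ ^ 2) :
    ∃ Θ : ReLUNet D 1, 1 ≤ Θ.depth ∧
      eLpNorm (fun z => max (g z) (stepMean P f V z) - Θ.toFun z) 2 ρ ≤ (δ₁ + δ₂ + δ₃ : ℝ≥0) ∧
      (Θ.size : ℝ) ≤ 50 * (Γ.size + K * (6 * A + 2 + 2 * Φ.size) + 2) ∧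
      growth Θ.toFun ≤ (γ' + 3 * A * γ : ℝ≥0) := by
  obtain ⟨Ψ, s1, s2, s3⟩ := hf.exists_net_stepMean hA ρ hM0 hM Φ hγ0 hγ hK
  obtain ⟨Θ, t1, t2, t3⟩ := Γ.exists_max Ψ
  refine ⟨Θ, t1, ?_, ?_, growth_max_le t3 hγ' s2⟩
  · have hΦm := Φ.continuous_toFun.measurable
    have hΨm := Ψ.continuous_toFun.measurable
    have m1 : Measurable fun z => g z - Γ.toFun z := hg.sub Γ.continuous_toFun.measurable
    have m2 := hf.measurable_stepMean hV
    have m3 := hf.measurable_stepMean hΦm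
    have m4 : Measurable fun z => stepMean P f V z - stepMean P f Φ.toFun z := m2.sub m3
    have m5 : Measurable fun z => stepMean P f Φ.toFun z - Ψ.toFun z := m3.sub hΨm
    have e3 : eLpNorm (fun z => stepMean P f Φ.toFun z - Ψ.toFun z) 2 ρ ≤ δ₃ :=
      eLpNorm_two_le (s3.trans (by exact_mod_cast h₃))
    have e2 := (hf.eLpNorm_stepMean_sub_le ρ hV hΦm hC (growth_le_iff.1 hγ)).trans h₂
    -- Three errors: the payoff network, the network for the next value, and the Monte Carlo sample.
    have hpt : ∀ z, ‖max (g z) (stepMean P f V z) - Θ.toFun z‖ₑ ≤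
        ‖‖g z - Γ.toFun z‖ + ‖stepMean P f V z - stepMean P f Φ.toFun z‖ +
          ‖stepMean P f Φ.toFun z - Ψ.toFun z‖‖ₑ := by
      intro z
      rw [t3]
      refine (enorm_max_sub_max_le _ _ _ _).trans ?_
      rw [Real.enorm_eq_ofReal (r := _ + _) (by positivity),
        ENNReal.ofReal_add (by positivity) (by positivity),
        ENNReal.ofReal_add (by positivity) (by positivity)]
      simp only [ofReal_norm]
      rw [add_assoc]
      gcongr
      rw [← sub_add_sub_cancel (stepMean P f V z) (stepMean P f Φ.toFun z) (Ψ.toFun z)]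
      exact enorm_add_le _ _
    calc _ ≤ eLpNorm (fun z => ‖g z - Γ.toFun z‖ +
          ‖stepMean P f V z - stepMean P f Φ.toFun z‖ +
          ‖stepMean P f Φ.toFun z - Ψ.toFun z‖) 2 ρ := eLpNorm_mono_enorm hpt
      _ ≤ eLpNorm (fun z => ‖g z - Γ.toFun z‖) 2 ρ +
          eLpNorm (fun z => ‖stepMean P f V z - stepMean P f Φ.toFun z‖) 2 ρ +
          eLpNorm (fun z => ‖stepMean P f Φ.toFun z - Ψ.toFun z‖) 2 ρ := by
        refine (eLpNorm_add_le (m1.norm.add m4.norm).aestronglyMeasurable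
          m5.norm.aestronglyMeasurable one_le_two).trans ?_
        gcongr
        exact eLpNorm_add_le m1.norm.aestronglyMeasurable m4.norm.aestronglyMeasurable one_le_two
      _ ≤ _ := by
        simp only [eLpNorm_norm]
        push_cast
        gcongr
  · have : (Θ.size : ℝ) ≤ 50 * (Γ.size + Ψ.size + 2) := by exact_mod_cast t2
    linarith

end OneStep

/-! ### Polynomially bounded functions -/

/-- `F` is bounded by a monomial on `[1, ∞)`. -/
def PolyBdd (F : ℝ≥0 → ℝ≥0) : Prop := ∃ C : ℕ, ∀ s, 1 ≤ s → F s ≤ C * s ^ C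

lemma monomial_mono {C C' : ℕ} (h : C ≤ C') {s : ℝ≥0} (hs : 1 ≤ s) :
    (C * s ^ C : ℝ≥0) ≤ C' * s ^ C' := by
  gcongr

namespace PolyBdd

variable {F G : ℝ≥0 → ℝ≥0}

lemma of_le (hG : PolyBdd G) (h : ∀ s, 1 ≤ s → F s ≤ G s) : PolyBdd F := by
  obtain ⟨C, hC⟩ := hG
  exact ⟨C, fun s hs => (h s hs).trans (hC s hs)⟩

lemma const (a : ℝ≥0) : PolyBdd fun _ => a := by
  refine ⟨⌈a⌉₊, fun s hs => (Nat.le_ceil a).trans ?_⟩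
  exact le_mul_of_one_le_right' (one_le_pow₀ hs)

lemma id : PolyBdd fun s => s := ⟨1, fun s _ => by simp⟩

lemma add (hF : PolyBdd F) (hG : PolyBdd G) : PolyBdd fun s => F s + G s := by
  obtain ⟨C, hC⟩ := hF
  obtain ⟨C', hC'⟩ := hG
  refine ⟨C + C', fun s hs => ?_⟩
  push_cast
  rw [add_mul]
  refine add_le_add ((hC s hs).trans ?_) ((hC' s hs).trans ?_)
  · gcongr
    omega
  · gcongr
    omega

lemma mul (hF : PolyBdd F) (hG : PolyBdd G) : PolyBdd fun s => F s * G s := by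
  obtain ⟨C, hC⟩ := hF
  obtain ⟨C', hC'⟩ := hG
  -- One number has to dominate both the coefficient `C * C'` and the exponent `C + C'`.
  refine ⟨C * C' + (C + C'), fun s hs => ?_⟩
  calc F s * G s ≤ (C * s ^ C) * (C' * s ^ C') := mul_le_mul' (hC s hs) (hC' s hs)
    _ = ((C * C' : ℕ) : ℝ≥0) * s ^ (C + C') := by push_cast; ring
    _ ≤ _ := mul_le_mul' (by exact_mod_cast Nat.le_add_right _ _)
      (pow_le_pow_right₀ hs (Nat.le_add_left _ _))

lemma pow (hF : PolyBdd F) (k : ℕ) : PolyBdd fun s => F s ^ k := by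
  induction k with
  | zero => simpa using const 1
  | succ k ih =>
    simp only [pow_succ]
    exact ih.mul hF

lemma comp_mul (hF : PolyBdd F) {a : ℝ≥0} (ha : 1 ≤ a) : PolyBdd fun s => F (a * s) := by
  obtain ⟨C, hC⟩ := hF
  refine of_le (((const C).mul ((const a).mul id |>.pow C))) fun s hs => ?_
  exact hC _ (one_le_mul ha hs)

lemma monomial (C : ℕ) : PolyBdd fun s => C * s ^ C := (const _).mul (id.pow C)

lemma rpow (hF : PolyBdd F) {r : ℝ} (hr : 0 ≤ r) : PolyBdd fun s => F s ^ r := by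
  -- The base is raised above one so that the exponent can be rounded up to an integer.
  refine of_le (((const 1).add hF).pow ⌈r⌉₊) fun s hs => ?_
  calc F s ^ r ≤ (1 + F s) ^ r := NNReal.rpow_le_rpow le_add_self hr
    _ ≤ (1 + F s) ^ ((⌈r⌉₊ : ℕ) : ℝ) :=
      NNReal.rpow_le_rpow_of_exponent_le le_self_add (Nat.le_ceil r)
    _ = _ := NNReal.rpow_natCast _ _

end PolyBdd

/-! ### Backward induction -/

/-- The payoff `g` is approximated by networks whose size is polynomial in the dimension and the
inverse of the accuracy. -/
def HasPayoffNets (C : ℕ) {D : ℕ} (g : Vec D → ℝ) : Prop :=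
  ∀ ε : ℝ≥0, 0 < ε → ε ≤ 1 → ∃ Γ : ReLUNet D 1, 1 ≤ Γ.depth ∧
    (∀ x, ‖g x - Γ.toFun x‖ₑ ≤ ε * (1 + ‖x‖ₑ)) ∧ (Γ.size : ℝ≥0) ≤ C * (D / ε) ^ C ∧
    growth Γ.toFun ≤ (C * D ^ C : ℝ≥0)

/-- Since `M ≥ 1`, the factor `√M` may be replaced by `M`, which keeps all constants monomial. -/
lemma eLpNorm_two_le_of_linear_growth {D : ℕ} {ρ : Measure (Vec D)} {M : ℝ≥0} (hM1 : 1 ≤ M)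
    (hM : ∫⁻ z, (1 + ‖z‖ₑ) ^ 2 ∂ρ ≤ M) {u : Vec D → ℝ} {a : ℝ≥0}
    (hu : ∀ x, ‖u x‖ₑ ≤ a * (1 + ‖x‖ₑ)) : eLpNorm u 2 ρ ≤ (a * M : ℝ≥0) := by
  refine eLpNorm_two_le ?_
  calc ∫⁻ z, ‖u z‖ₑ ^ 2 ∂ρ ≤ ∫⁻ z, a ^ 2 * (1 + ‖z‖ₑ) ^ 2 ∂ρ := by
        refine lintegral_mono fun z => ?_
        rw [← mul_pow]
        exact pow_le_pow_left' (hu z) 2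
    _ = a ^ 2 * ∫⁻ z, (1 + ‖z‖ₑ) ^ 2 ∂ρ := lintegral_const_mul' _ _ (by finiteness)
    _ ≤ a ^ 2 * (M : ℝ≥0∞) ^ 2 := by
        gcongr
        exact hM.trans (le_self_pow (by exact_mod_cast hM1) two_ne_zero)
    _ = _ := by push_cast; ring

lemma one_le_of_moment {D : ℕ} {ρ : Measure (Vec D)} [IsProbabilityMeasure ρ] {M : ℝ≥0}
    (hM : ∫⁻ z, (1 + ‖z‖ₑ) ^ 2 ∂ρ ≤ M) : 1 ≤ M := by
  have : (1 : ℝ≥0∞) ≤ M := by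
    refine le_trans ?_ hM
    calc (1 : ℝ≥0∞) = ∫⁻ _, 1 ∂ρ := by simp
      _ ≤ _ := lintegral_mono fun z => one_le_pow₀ le_self_add
  exact_mod_cast this

universe u

/-- The values at time `n` of all chains with constants `C` are approximated in `L²(ρ)`, for all
laws `ρ` with second moments bounded by the monomial with constant `C'`. -/
def HasValueNets (N C n C' E : ℕ) : Prop :=
  ∀ (D : ℕ), 1 ≤ D → ∀ (Ω : Type u) (mΩ : MeasurableSpace Ω) (P : Measure Ω)
    (_ : IsProbabilityMeasure P) (𝓖 : ℕ → MeasurableSpace Ω) (f : ℕ → Vec D → Ω → Vec D)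
    (h : ℕ → Vec D → ℝ), IsChain P 𝓖 N f h (C * D ^ C) (C * D ^ C) →
    (∀ m, m ≤ N → HasPayoffNets C (h m)) →
    ∀ ρ : Measure (Vec D), IsProbabilityMeasure ρ →
    ∫⁻ z, (1 + ‖z‖ₑ) ^ 2 ∂ρ ≤ (C' * D ^ C' : ℝ≥0) → ∀ ε : ℝ≥0, 0 < ε → ε ≤ 1 →
    ∃ Φ : ReLUNet D 1, 1 ≤ Φ.depth ∧ eLpNorm (fun z => snell P f h N n z - Φ.toFun z) 2 ρ ≤ ε ∧
      (Φ.size : ℝ≥0) ≤ E * (D / ε) ^ E ∧ growth Φ.toFun ≤ (E * (D / ε) ^ E : ℝ≥0)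

lemma le_div_of_le_one {D : ℕ} {ε : ℝ≥0} (hε : 0 < ε) (hε1 : ε ≤ 1) : (D : ℝ≥0) ≤ D / ε := by
  rw [le_div_iff₀ hε]
  exact mul_le_of_le_one_right' hε1

lemma exists_hasValueNets_last (N C C' : ℕ) : ∃ E, HasValueNets.{u} N C N C' E := by
  obtain ⟨E, hE⟩ : PolyBdd fun s => C * (s * (C' * s ^ C')) ^ C + C * s ^ C :=
    ((PolyBdd.const _).mul ((PolyBdd.id.mul (.monomial C')).pow C)).add (.monomial C)
  refine ⟨E, fun D hD Ω mΩ P _ 𝓖 f h hc hg ρ _ hM ε hε hε1 => ?_⟩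
  set M : ℝ≥0 := C' * D ^ C' with hMdef
  have hM1 : 1 ≤ M := one_le_of_moment hM
  have hM0 : 0 < M := zero_lt_one.trans_le hM1
  have hDs := le_div_of_le_one (D := D) hε hε1
  set s : ℝ≥0 := D / ε with hs
  have hs1 : 1 ≤ s := le_trans (by exact_mod_cast hD) hDs
  have hMs : M ≤ C' * s ^ C' := by rw [hMdef]; gcongr
  -- The accuracy `ε / M` offsets the factor `M` lost in passing from the weighted pointwise bound
  -- to `L²(ρ)`.
  obtain ⟨Γ, h1, h2, h3, h4⟩ := hg N le_rfl (ε / M) (by positivity)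
    ((div_le_self zero_le hM1).trans hε1)
  refine ⟨Γ, h1, ?_, ?_, h4.trans ?_⟩
  · rw [snell_self]
    refine (eLpNorm_two_le_of_linear_growth hM1 hM h2).trans (le_of_eq ?_)
    rw [div_mul_cancel₀ _ hM0.ne']
  · refine (h3.trans ?_).trans ((le_self_add).trans (hE s hs1))
    rw [show (D : ℝ≥0) / (ε / M) = s * M by rw [hs]; field_simp]
    gcongr
  · refine ENNReal.coe_le_coe.2 (le_trans ?_ (le_add_self.trans (hE s hs1)))
    gcongr

/-- The hypothesis is needed for all moment constants, because one step multiplies the bound of the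
second moment by `A`. As `E` is fixed before the dimension, the problem, the law and the accuracy,
all bounds are first collected as polynomials in `s = D / ε`. -/
lemma HasValueNets.exists_pred {N C n : ℕ} (hn : n < N) (hC : 1 ≤ C)
    (ih : ∀ C', ∃ E, HasValueNets.{u} N C (n + 1) C' E) (C' : ℕ) :
    ∃ E, HasValueNets.{u} N C n C' E := by
  -- A monomial constant for the product of `C * D ^ C` and `C' * D ^ C'`, which bounds the second
  -- moment after one step.
  obtain ⟨E', hE'⟩ := ih (C * C' + (C + C'))
  have pg : PolyBdd fun s => E' * (4 * s) ^ E' + 1 :=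
    ((PolyBdd.monomial E').comp_mul (by norm_num)).add (.const 1)
  have pA := PolyBdd.monomial C
  have pM := PolyBdd.monomial C'
  have pK : PolyBdd fun s => 48 * (E' * (4 * s) ^ E' + 1) ^ 2 * (C * s ^ C) * (C' * s ^ C') * s ^ 2
      + 2 := (((((PolyBdd.const 48).mul (pg.pow 2)).mul pA).mul pM).mul (PolyBdd.id.pow 2)).add
        (.const 2)
  have pS : PolyBdd fun s => C * (4 * s * (C' * s ^ C')) ^ C :=
    (PolyBdd.const _).mul ((((PolyBdd.const 4).mul .id).mul pM).pow C)
  have pSize : PolyBdd fun s => 50 * (C * (4 * s * (C' * s ^ C')) ^ C +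
      (48 * (E' * (4 * s) ^ E' + 1) ^ 2 * (C * s ^ C) * (C' * s ^ C') * s ^ 2 + 2) *
        (6 * (C * s ^ C) + 2 + 2 * (E' * (4 * s) ^ E' + 1)) + 2) :=
    (PolyBdd.const 50).mul ((pS.add (pK.mul ((((PolyBdd.const 6).mul pA).add (.const 2)).add
      ((PolyBdd.const 2).mul pg)))).add (.const 2))
  have pGr : PolyBdd fun s => C * s ^ C + 3 * (C * s ^ C) * (E' * (4 * s) ^ E' + 1) :=
    pA.add (((PolyBdd.const 3).mul pA).mul pg)
  obtain ⟨E, hE⟩ := pSize.add pGr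
  refine ⟨E, fun D hD Ω mΩ P _ 𝓖 f h hc hg ρ _ hM ε hε hε1 => ?_⟩
  have hD1 : (1 : ℝ≥0) ≤ D := by exact_mod_cast hD
  set A : ℝ≥0 := C * D ^ C with hAdef
  set M : ℝ≥0 := C' * D ^ C' with hMdef
  have hA0 : A ≠ 0 := by
    have : (1 : ℝ≥0) ≤ C := by exact_mod_cast hC
    positivity
  have hM1 : 1 ≤ M := one_le_of_moment hM
  have hM0 : 0 < M := zero_lt_one.trans_le hM1
  have hDs := le_div_of_le_one (D := D) hε hε1
  set s : ℝ≥0 := D / ε with hs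
  have hs1 : 1 ≤ s := hD1.trans hDs
  have hεs : ε⁻¹ ≤ s := by
    rw [hs, div_eq_mul_inv]
    exact le_mul_of_one_le_left' hD1
  have hMs : M ≤ C' * s ^ C' := by rw [hMdef]; gcongr
  have hAs : A ≤ C * s ^ C := by rw [hAdef]; gcongr
  have hstep := hc.step n hn
  have := hstep.isProbabilityMeasure_stepLaw ρ
  have hM' : ∫⁻ z, (1 + ‖z‖ₑ) ^ 2 ∂stepLaw P (f n) ρ ≤
      (((C * C' + (C + C') : ℕ) : ℝ≥0) * D ^ (C * C' + (C + C')) : ℝ≥0) := by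
    refine (hstep.moment_stepLaw_le ρ hM).trans ?_
    norm_cast
    push_cast
    calc A * M = ((C * C' : ℕ) : ℝ≥0) * D ^ (C + C') := by rw [hAdef, hMdef]; push_cast; ring
      _ ≤ ((C * C' + (C + C') : ℕ) : ℝ≥0) * D ^ (C * C' + (C + C')) :=
        mul_le_mul' (by exact_mod_cast Nat.le_add_right _ _)
          (pow_le_pow_right₀ hD1 (Nat.le_add_left _ _))
      _ = _ := by push_cast; ring
  have hε4 : ε / 4 ≤ 1 := (div_le_self zero_le (by norm_num)).trans hε1
  -- Each of the three errors receives a quarter of `ε`.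
  obtain ⟨Φ, -, a2, a3, a4⟩ := hE' D hD Ω mΩ P ‹_› 𝓖 f h hc hg _ this hM' (ε / 4) (by positivity) hε4
  rw [show (D : ℝ≥0) / (ε / 4) = 4 * s by rw [hs]; field_simp] at a3 a4
  obtain ⟨Γ, -, b2, b3, b4⟩ := hg n hn.le (ε / (4 * M)) (by positivity)
    ((div_le_self zero_le (one_le_mul (by norm_num) hM1)).trans hε1)
  rw [show (D : ℝ≥0) / (ε / (4 * M)) = 4 * s * M by rw [hs]; field_simp] at b3
  -- The summand `1` keeps `γ` non-zero.
  set γ : ℝ≥0 := E' * (4 * s) ^ E' + 1 with hγ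
  have hΓ : eLpNorm (fun z => h n z - Γ.toFun z) 2 ρ ≤ (ε / 4 : ℝ≥0) := by
    refine (eLpNorm_two_le_of_linear_growth hM1 hM b2).trans (le_of_eq ?_)
    congr 1
    field_simp
  have a4' : growth Φ.toFun ≤ (γ : ℝ≥0) := a4.trans (by rw [hγ]; norm_cast; exact le_self_add)
  -- Since `48 = 3 * 4 ^ 2` and `ε⁻¹ ≤ s`, the Monte Carlo bound `3 * γ ^ 2 * A * M / K` is at most
  -- `(ε / 4) ^ 2`. Using `s` instead of `ε⁻¹` keeps `K` polynomial in `s`, and `+ 1` makes it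
  -- positive.
  set K : ℕ := ⌈48 * γ ^ 2 * A * M * s ^ 2⌉₊ + 1 with hK
  have hK1 : 48 * γ ^ 2 * A * M * s ^ 2 ≤ K := by
    rw [hK]
    push_cast
    exact (Nat.le_ceil _).trans le_self_add
  have hK2 : (K : ℝ≥0) ≤ 48 * γ ^ 2 * A * M * s ^ 2 + 2 := by
    rw [hK]
    push_cast
    have := (Nat.ceil_lt_add_one (zero_le : 0 ≤ 48 * γ ^ 2 * A * M * s ^ 2)).le
    calc _ ≤ (48 * γ ^ 2 * A * M * s ^ 2 + 1) + 1 := by gcongr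
      _ = _ := by ring
  have h3 : 3 * ((K : ℝ≥0)⁻¹ * (γ ^ 2 * (A * M))) ≤ (ε / 4) ^ 2 := by
    have hKpos : (0 : ℝ≥0) < K := by rw [hK]; positivity
    have h48 : 48 * γ ^ 2 * A * M * ε⁻¹ ^ 2 ≤ K := le_trans (by gcongr) hK1
    calc 3 * ((K : ℝ≥0)⁻¹ * (γ ^ 2 * (A * M)))
        = (48 * γ ^ 2 * A * M * ε⁻¹ ^ 2) * ((K : ℝ≥0)⁻¹ * (ε / 4) ^ 2) := by field_simp; ring
      _ ≤ K * ((K : ℝ≥0)⁻¹ * (ε / 4) ^ 2) := by gcongr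
      _ = (ε / 4) ^ 2 := by field_simp
  obtain ⟨Θ, t1, t2, t3, t4⟩ := hstep.exists_net_max hA0 ρ hM0.ne' hM (hc.measurable_snell hn)
    (hc.payoff_measurable n hn.le) (hc.enorm_snell_le hn) Φ Γ (by positivity : γ ≠ 0) a4' b4
    (Nat.succ_pos _ : 0 < K) hΓ a2 h3
  refine ⟨Θ, t1, ?_, ?_, t4.trans ?_⟩
  · simp only [snell_of_lt P f h hn]
    refine t2.trans ?_
    norm_cast
    calc ε / 4 + ε / 4 + ε / 4 = ε * (3 / 4) := by ring
      _ ≤ ε := mul_le_of_le_one_right' (by rw [div_le_one (by norm_num)]; norm_num)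
  · have t3' : (Θ.size : ℝ≥0) ≤ 50 * (Γ.size + K * (6 * A + 2 + 2 * Φ.size) + 2) := by
      exact_mod_cast t3
    refine t3'.trans (le_trans ?_ (le_self_add.trans (hE s hs1)))
    gcongr
    · exact b3.trans (by gcongr)
    · exact hK2.trans (by gcongr)
    · exact a3.trans le_self_add
  · refine ENNReal.coe_le_coe.2 (le_trans ?_ (le_add_self.trans (hE s hs1)))
    gcongr

lemma exists_hasValueNets {N C n : ℕ} (hn : n ≤ N) (hC : 1 ≤ C) :
    ∀ C', ∃ E, HasValueNets.{u} N C n C' E := by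
  induction hn using Nat.decreasingInduction with
  | self => exact exists_hasValueNets_last N C
  | of_succ n hn ih => exact HasValueNets.exists_pred hn hC ih

/-! ### From the assumptions to chains with polynomial constants -/

/-- On a probability space the `p`-norm dominates the `2`-norm. Higher moments enter only through
this lemma; everything else uses second moments. -/
lemma lintegral_one_add_sq_le {α : Type*} [MeasurableSpace α] {μ : Measure α}
    [IsProbabilityMeasure μ] {u : α → ℝ≥0∞} (hu : AEMeasurable u μ) {p : ℝ} (hp : 2 ≤ p) {B : ℝ≥0}
    (hB : (∫⁻ x, u x ^ p ∂μ) ^ (1 / p) ≤ B) :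
    ∫⁻ x, (1 + u x) ^ 2 ∂μ ≤ (3 * (1 + B ^ 2) : ℝ≥0) := by
  have h := eLpNorm'_le_eLpNorm'_of_exponent_le two_pos hp μ hu.aestronglyMeasurable
  simp only [eLpNorm', enorm_eq_self] at h
  have h2 : ∫⁻ x, u x ^ 2 ∂μ ≤ B ^ 2 := by
    have h3 := ENNReal.rpow_le_rpow (h.trans hB) (z := 2) zero_le_two
    rw [← ENNReal.rpow_mul] at h3
    simpa using h3
  have hpt : ∀ x, (1 + u x) ^ 2 ≤ 3 * (1 + u x ^ 2) := by
    intro x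
    have : u x ≤ 1 + u x ^ 2 := by
      rcases le_total (u x) 1 with h | h
      · exact h.trans le_self_add
      · exact (le_self_pow h two_ne_zero).trans le_add_self
    calc (1 + u x) ^ 2 = 1 + 2 * u x + u x ^ 2 := by ring
      _ ≤ 1 + 2 * (1 + u x ^ 2) + u x ^ 2 := by gcongr
      _ = 3 * (1 + u x ^ 2) := by ring
  calc _ ≤ ∫⁻ x, 3 * (1 + u x ^ 2) ∂μ := lintegral_mono hpt
    _ = 3 * (1 + ∫⁻ x, u x ^ 2 ∂μ) := by
      rw [lintegral_const_mul' _ _ (by finiteness), lintegral_add_left measurable_const]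
      simp
    _ ≤ 3 * (1 + B ^ 2) := by gcongr
    _ = _ := by simp

lemma DynamicAssumption.isStep {Ω : Type*} {mΩ : MeasurableSpace Ω} {P : Measure Ω}
    [IsProbabilityMeasure P] {𝓕 : Filtration ℝ≥0 mΩ} {T : ℝ≥0} {N D : ℕ} {x₀ : Vec D}
    {X : ℝ≥0 → Ω → Vec D} {f : ℕ → Vec D → Ω → Vec D} {p c q : ℝ} (hp : 2 < p)
    (H : DynamicAssumption P 𝓕 T N x₀ X f p c q) {n : ℕ} (hn : n < N) {A B : ℝ≥0}
    (hB : c * (D : ℝ) ^ q = B) (hA : 3 * (1 + B ^ 2) ≤ A) (hBA : B ≤ A) : IsStep P (f n) A := by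
  obtain ⟨L, -, θ, hθ, hfθ, hsize⟩ := H.ranNN n hn
  have hgr := H.growth_le n hn
  rw [hB, ENNReal.ofReal_coe_nnreal] at hsize hgr
  have hm : Measurable (Function.uncurry (f n)) :=
    (H.measurable_step n hn).mono (sup_le_sup le_rfl (MeasurableSpace.comap_mono (𝓕.le _))) le_rfl
  have hS := measurable_infSize hθ
  have hnet : ∀ᵐ ω ∂P, ∀ s : ℕ, (infSize (θ ω) : ℝ≥0∞) ≤ s →
      HasNet (L + 1) s fun (x : Fin D → ℝ) i => f n (WithLp.toLp 2 x) ω i := by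
    filter_upwards [hfθ] with ω hω s hs
    simp only [hω]
    refine hasNet_infEval (θ ω) ?_
    rw [← ENat.toENNReal_le]
    simpa using hs
  -- A finite expected size makes the size almost surely finite, so almost every realization is a
  -- finite network and hence continuous.
  have hcont : ∀ᵐ ω ∂P, Continuous fun x => f n x ω := by
    filter_upwards [hnet, ae_lt_top hS (hsize.trans_lt ENNReal.coe_lt_top).ne] with ω h1 h2
    obtain ⟨s, hs⟩ := ENNReal.exists_nat_gt h2.ne
    have h3 := (h1 s hs.le).continuous
    exact (PiLp.continuous_toLp 2 fun _ : Fin D => ℝ).comp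
      (h3.comp (PiLp.continuous_ofLp 2 fun _ : Fin D => ℝ))
  refine ⟨hm, hcont, ?_, L, _, hS, hsize.trans (by exact_mod_cast hBA), hnet⟩
  refine (lintegral_one_add_sq_le (aemeasurable_growth
    (fun x => hm.comp measurable_prodMk_left) hcont) hp.le hgr).trans ?_
  exact_mod_cast hA

/-! ### Consequences of the payoff assumption -/

section Payoff

variable {T : ℝ≥0} {N D : ℕ} {g : ℝ≥0 → Vec D → ℝ} {c q r : ℝ} {B : ℝ≥0}

lemma PayoffAssumption.exists_net (H : PayoffAssumption T N g c q r)
    (hB : c * (D : ℝ) ^ q = B) (hB0 : B ≠ 0) {n : ℕ} (hn : n ≤ N) {ε : ℝ≥0} (hε : 0 < ε) :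
    ∃ Γ : ReLUNet D 1, 1 ≤ Γ.depth ∧
      (∀ x, ‖g (monitorTime T N n) x - Γ.toFun x‖ₑ ≤ ε * (1 + ‖x‖ₑ)) ∧
      (Γ.size : ℝ≥0) ≤ B * (B / ε) ^ r ∧
      (∀ x, ‖Γ.toFun x - Γ.toFun 0‖ₑ ≤ B * ‖x‖ₑ) ∧ ‖g (monitorTime T N n) 0‖ₑ ≤ B := by
  -- The accuracy `ε / B` cancels the factor `c * D ^ q = B` of the error bound.
  obtain ⟨Γ, h1, h2, h3, h4, h5⟩ := H (ε / B) (by positivity) n hn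
  have hB0' : (B : ℝ) ≠ 0 := by exact_mod_cast hB0
  refine ⟨Γ, h1, fun x => ?_, ?_, fun x => ?_, ?_⟩
  · have h6 := h2 x
    rw [mul_assoc (_ / _), hB, div_mul_cancel₀ _ hB0', abs_sub_comm] at h6
    rw [Real.enorm_eq_ofReal_abs]
    refine (ENNReal.ofReal_le_ofReal h6).trans (le_of_eq ?_)
    rw [ENNReal.ofReal_mul (by positivity), ENNReal.ofReal_add zero_le_one (norm_nonneg _),
      ofReal_norm]
    simp
  · rw [hB, Real.rpow_neg (by positivity), ← Real.inv_rpow (by positivity), inv_div] at h3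
    rw [← NNReal.coe_le_coe]
    push_cast
    exact h3
  · rcases eq_or_ne x 0 with rfl | hx
    · simp
    · have h6 : ‖Γ.toFun x - Γ.toFun 0‖ₑ / ‖x - 0‖ₑ ≤ lipConst Γ.toFun := by
        refine le_trans ?_ (le_iSup _ x)
        refine le_trans ?_ (le_iSup _ 0)
        exact le_iSup (fun _ : x ≠ 0 => ‖Γ.toFun x - Γ.toFun 0‖ₑ / ‖x - 0‖ₑ) hx
      rw [sub_zero] at h6
      rw [hB, ENNReal.ofReal_coe_nnreal] at h4
      exact (ENNReal.div_le_iff (by simpa using hx) (by simp)).1 (h6.trans h4)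
  · rw [Real.enorm_eq_ofReal_abs, ← ENNReal.ofReal_coe_nnreal, ← hB]
    exact ENNReal.ofReal_le_ofReal h5

/-- Linear growth of the payoff comes from a network of accuracy one, its Lipschitz constant and the
value of `g` at the origin. -/
lemma PayoffAssumption.enorm_le (H : PayoffAssumption T N g c q r)
    (hB : c * (D : ℝ) ^ q = B) (hB0 : B ≠ 0) {n : ℕ} (hn : n ≤ N) (x : Vec D) :
    ‖g (monitorTime T N n) x‖ₑ ≤ (B + 2 : ℝ≥0) * (1 + ‖x‖ₑ) := by
  obtain ⟨Γ, -, h2, -, h4, h5⟩ := H.exists_net hB hB0 hn one_pos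
  set G := g (monitorTime T N n)
  have e : G x = (G x - Γ.toFun x) + (Γ.toFun x - Γ.toFun 0) + (-(G 0 - Γ.toFun 0)) + G 0 := by ring
  have h0 := h2 0
  have hx := h2 x
  simp only [ENNReal.coe_one, one_mul, enorm_zero, add_zero] at h0 hx
  calc ‖G x‖ₑ ≤ ‖G x - Γ.toFun x‖ₑ + ‖Γ.toFun x - Γ.toFun 0‖ₑ + ‖-(G 0 - Γ.toFun 0)‖ₑ + ‖G 0‖ₑ := by
        conv_lhs => rw [e]
        refine (enorm_add_le _ _).trans ?_
        gcongr
        refine (enorm_add_le _ _).trans ?_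
        gcongr
        exact enorm_add_le _ _
    _ ≤ (1 + ‖x‖ₑ) + B * ‖x‖ₑ + 1 + B := by
        rw [enorm_neg]
        gcongr
        exact h4 x
    _ ≤ (1 + ‖x‖ₑ) + B * ‖x‖ₑ + (1 + ‖x‖ₑ) + B := by
        gcongr
        exact le_self_add
    _ = _ := by
        push_cast
        ring

/-- At each monitoring time the payoff is a pointwise limit of networks, which are continuous. -/
lemma PayoffAssumption.measurable (H : PayoffAssumption T N g c q r)
    (hB : c * (D : ℝ) ^ q = B) (hB0 : B ≠ 0) {n : ℕ} (hn : n ≤ N) :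
    Measurable (g (monitorTime T N n)) := by
  choose Γ h1 h2 using fun k : ℕ => H.exists_net hB hB0 hn (ε := ((k : ℝ≥0) + 1)⁻¹) (by positivity)
  refine measurable_of_tendsto_metrizable (f := fun k => (Γ k).toFun)
    (fun k => (Γ k).continuous_toFun.measurable) (tendsto_pi_nhds.2 fun x => ?_)
  rw [tendsto_iff_edist_tendsto_0]
  have hlim : Filter.Tendsto (fun k : ℕ => ((((k : ℝ≥0) + 1)⁻¹ * (1 + ‖x‖₊) : ℝ≥0) : ℝ≥0∞))
      Filter.atTop (nhds 0) := by
    rw [← ENNReal.coe_zero, ENNReal.tendsto_coe, ← zero_mul (1 + ‖x‖₊)]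
    refine Filter.Tendsto.mul_const _ ?_
    rw [← NNReal.tendsto_coe]
    refine (tendsto_one_div_add_atTop_nhds_zero_nat (𝕜 := ℝ)).congr fun k => ?_
    simp
  refine tendsto_of_tendsto_of_tendsto_of_le_of_le tendsto_const_nhds hlim (fun _ => zero_le)
    fun k => ?_
  rw [edist_comm, edist_eq_enorm_sub]
  refine ((h2 k).1 x).trans (le_of_eq ?_)
  rw [enorm_eq_nnnorm]
  push_cast
  rfl

lemma PayoffAssumption.hasPayoffNets (H : PayoffAssumption T N g c q r)
    (hB : c * (D : ℝ) ^ q = B) (hB0 : B ≠ 0) {n : ℕ} (hn : n ≤ N) {C : ℕ}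
    (hC : B + 3 ≤ C * D ^ C)
    (hsize : ∀ ε : ℝ≥0, 0 < ε → ε ≤ 1 → B * (B / ε) ^ r ≤ C * (D / ε) ^ C) :
    HasPayoffNets C (g (monitorTime T N n)) := by
  intro ε hε hε1
  obtain ⟨Γ, h1, h2, h3, -, -⟩ := H.exists_net hB hB0 hn hε
  refine ⟨Γ, h1, h2, h3.trans (hsize ε hε hε1), growth_le_iff.2 fun x => ?_⟩
  have e1 := H.enorm_le hB hB0 hn x
  have e2 : ‖g (monitorTime T N n) x - Γ.toFun x‖ₑ ≤ 1 * (1 + ‖x‖ₑ) :=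
    (h2 x).trans (by gcongr; exact_mod_cast hε1)
  calc ‖Γ.toFun x‖ₑ = ‖g (monitorTime T N n) x - (g (monitorTime T N n) x - Γ.toFun x)‖ₑ := by
        rw [sub_sub_cancel]
    _ ≤ ‖g (monitorTime T N n) x‖ₑ + ‖g (monitorTime T N n) x - Γ.toFun x‖ₑ := enorm_sub_le
    _ ≤ (B + 2 : ℝ≥0) * (1 + ‖x‖ₑ) + 1 * (1 + ‖x‖ₑ) := add_le_add e1 e2
    _ = ((B + 3 : ℝ≥0) : ℝ≥0∞) * (1 + ‖x‖ₑ) := by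
        push_cast
        ring
    _ ≤ _ := by gcongr

end Payoff

/-! ### Constants uniform over all problems -/

lemma monitorTime_mono (T : ℝ≥0) (N : ℕ) : Monotone (monitorTime T N) := by
  intro m n h
  unfold monitorTime
  gcongr

/-- The constants of all problems that satisfy the assumptions are bounded by one monomial. -/
lemma exists_chain_constant (N : ℕ) {p c q r : ℝ} (hp : 2 < p) (hc : 0 < c) (hq : 0 < q)
    (hr : 0 < r) : ∃ C : ℕ, 1 ≤ C ∧ ∀ (D : ℕ), 1 ≤ D → ∀ (T : ℝ≥0) (Ω : Type*)
      (mΩ : MeasurableSpace Ω) (P : Measure Ω) (_ : IsProbabilityMeasure P)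
      (𝓕 : Filtration ℝ≥0 mΩ) (x₀ : Vec D) (X : ℝ≥0 → Ω → Vec D) (f : ℕ → Vec D → Ω → Vec D)
      (g : ℝ≥0 → Vec D → ℝ), DynamicAssumption P 𝓕 T N x₀ X f p c q →
      PayoffAssumption T N g c q r →
      IsChain P (fun m => 𝓕 (monitorTime T N m)) N f (fun m => g (monitorTime T N m))
        (C * D ^ C) (C * D ^ C) ∧
      ∀ m, m ≤ N → HasPayoffNets C (g (monitorTime T N m)) := by
  lift c to ℝ≥0 using hc.le
  have hc' : c ≠ 0 := by exact_mod_cast hc.ne'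
  have pb : PolyBdd fun s => c * s ^ q := (PolyBdd.const c).mul (PolyBdd.id.rpow hq.le)
  have p1 : PolyBdd fun s => 3 * (1 + (c * s ^ q) ^ 2) :=
    (PolyBdd.const 3).mul ((PolyBdd.const 1).add (pb.pow 2))
  have p2 : PolyBdd fun s => c * s ^ q + 3 := pb.add (.const 3)
  -- For `s = D / ε` both `D` and `ε⁻¹` are at most `s`, so this function dominates the payoff
  -- network size `B * (B / ε) ^ r`.
  have p3 : PolyBdd fun s => c * s ^ q * (c * s ^ q * s) ^ r := pb.mul ((pb.mul .id).rpow hr.le)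
  obtain ⟨C₀, hC₀⟩ := (p1.add p2).add p3
  -- The successor of `C₀` is still admissible and is at least one.
  have hC₁ : ∀ s : ℝ≥0, 1 ≤ s → _ := fun s hs =>
    (hC₀ s hs).trans (monomial_mono (Nat.le_succ C₀) hs)
  refine ⟨C₀ + 1, Nat.le_add_left _ _, fun D hD T Ω mΩ P _ 𝓕 x₀ X f g hX hg => ?_⟩
  have hD1 : (1 : ℝ≥0) ≤ D := by exact_mod_cast hD
  set B : ℝ≥0 := c * D ^ q with hBdef
  have hB : (c : ℝ) * (D : ℝ) ^ q = B := by rw [hBdef]; push_cast; rfl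
  have hB0 : B ≠ 0 := by
    have : (0 : ℝ≥0) < D := zero_lt_one.trans_le hD1
    exact mul_ne_zero hc' (NNReal.rpow_pos this).ne'
  have hA := hC₁ D hD1
  have hA2 : B + 3 ≤ ((C₀ + 1 : ℕ) : ℝ≥0) * (D : ℝ≥0) ^ (C₀ + 1) :=
    (le_add_self.trans le_self_add).trans hA
  refine ⟨⟨fun m => 𝓕.le _, fun m n h => 𝓕.mono (monitorTime_mono T N h), fun m hm =>
    hX.isStep hp hm hB ((le_self_add.trans le_self_add).trans hA) (le_self_add.trans hA2),
    hX.measurable_step, hX.indep, fun m hm => hg.measurable hB hB0 hm, fun m hm x =>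
    (hg.enorm_le hB hB0 hm x).trans ?_⟩, fun m hm => hg.hasPayoffNets hB hB0 hm hA2 ?_⟩
  · gcongr
    exact (add_le_add le_rfl (by norm_num)).trans hA2
  · intro ε hε hε1
    have hDs := le_div_of_le_one (D := D) hε hε1
    have hεs : ε⁻¹ ≤ D / ε := by
      rw [div_eq_mul_inv]
      exact le_mul_of_one_le_left' hD1
    refine le_trans ?_ (le_add_self.trans (hC₁ (D / ε) (hD1.trans hDs)))
    have hBs : B ≤ c * (D / ε) ^ q := by
      rw [hBdef]
      gcongr
    rw [div_eq_mul_inv B]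
    gcongr

/-- The second moment bound implied by a bound of a higher moment. -/
lemma exists_moment_constant (k π : ℝ) : ∃ C' : ℕ, ∀ (D : ℕ), 1 ≤ D → ∀ ρ : Measure (Vec D),
    IsProbabilityMeasure ρ → ∀ p : ℝ, 2 ≤ p →
    (∫⁻ z, ‖z‖ₑ ^ p ∂ρ) ^ (1 / p) ≤ ENNReal.ofReal (k * (D : ℝ) ^ π) →
    ∫⁻ z, (1 + ‖z‖ₑ) ^ 2 ∂ρ ≤ (C' * D ^ C' : ℝ≥0) := by
  -- Absolute values allow `k` and `π` of any sign.
  obtain ⟨C', hC'⟩ : PolyBdd fun s => 3 * (1 + (‖k‖₊ * s ^ |π|) ^ 2) :=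
    (PolyBdd.const 3).mul ((PolyBdd.const 1).add
      (((PolyBdd.const _).mul (PolyBdd.id.rpow (abs_nonneg π))).pow 2))
  refine ⟨C', fun D hD ρ _ p hp h => ?_⟩
  have hD1 : (1 : ℝ) ≤ D := by exact_mod_cast hD
  refine (lintegral_one_add_sq_le (B := ‖k‖₊ * (D : ℝ≥0) ^ |π|) measurable_enorm.aemeasurable hp
    (h.trans ?_)).trans (ENNReal.coe_le_coe.2 (hC' D (by exact_mod_cast hD)))
  rw [← ENNReal.ofReal_coe_nnreal]
  refine ENNReal.ofReal_le_ofReal ?_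
  push_cast
  rw [Real.norm_eq_abs]
  gcongr
  · exact le_abs_self k
  · exact le_abs_self π

/-- The values have polynomially bounded norms in `L²(ρ)`. -/
lemma exists_value_constant (N C C' : ℕ) : ∃ R : ℕ, ∀ (D : ℕ), 1 ≤ D → ∀ (Ω : Type*)
    (mΩ : MeasurableSpace Ω) (P : Measure Ω) (𝓕 : Filtration ℝ≥0 mΩ) (T : ℝ≥0)
    (f : ℕ → Vec D → Ω → Vec D) (g : ℝ≥0 → Vec D → ℝ),
    IsChain P (fun m => 𝓕 (monitorTime T N m)) N f (fun m => g (monitorTime T N m))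
      (C * D ^ C) (C * D ^ C) → ∀ n, n ≤ N → ∀ ρ : Measure (Vec D), IsProbabilityMeasure ρ →
    ∫⁻ z, (1 + ‖z‖ₑ) ^ 2 ∂ρ ≤ (C' * D ^ C' : ℝ≥0) →
    eLpNorm (snell P f (fun m => g (monitorTime T N m)) N n) 2 ρ ≤ (R * D ^ R : ℝ≥0) := by
  obtain ⟨R, hR⟩ : PolyBdd fun s => C * s ^ C * (1 + C * s ^ C) ^ N * (C' * s ^ C') :=
    ((PolyBdd.monomial C).mul (((PolyBdd.const 1).add (.monomial C)).pow N)).mul (.monomial C')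
  refine ⟨R, fun D hD Ω mΩ P 𝓕 T f g H n hn ρ _ hM => ?_⟩
  exact (eLpNorm_two_le_of_linear_growth (one_le_of_moment hM) hM (H.enorm_snell_le hn)).trans
    (ENNReal.coe_le_coe.2 (hR D (by exact_mod_cast hD)))

/-- Networks are built with accuracy `min ε 1`, but the size bound has to decay in `ε` also beyond
`1`. There `ε ≤ R * D ^ R`, so `ε ^ (E + 1)` is absorbed into the constant and the power of `D`. The
added ones make both final exponents at least one. -/
lemma monomial_min_le {E R : ℕ} {D ε : ℝ≥0} (hD : 1 ≤ D) (hε : 0 < ε) (hεR : ε ≤ R * D ^ R) :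
    E * (D / min ε 1) ^ E ≤
      (E + 1) * (R + 1) ^ (E + 1) * D ^ (E + R * (E + 1) + 1) * (ε ^ (E + 1))⁻¹ := by
  rcases le_total ε 1 with h | h
  · rw [min_eq_left h, div_eq_mul_inv, mul_pow, ← inv_pow, ← mul_assoc]
    have h1 : (1 : ℝ≥0) ≤ ε⁻¹ := (one_le_inv₀ hε).2 h
    gcongr ?_ * ?_ * ?_
    · exact le_self_add.trans (le_mul_of_one_le_right' (one_le_pow₀ le_add_self))
    · exact pow_le_pow_right₀ hD (by omega)
    · exact pow_le_pow_right₀ h1 (Nat.le_succ E)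
  · rw [min_eq_right h, div_one, ← div_eq_mul_inv, le_div_iff₀ (by positivity)]
    calc E * D ^ E * ε ^ (E + 1) ≤ (E + 1) * D ^ E * ((R + 1) * D ^ R) ^ (E + 1) := by
          gcongr
          · exact le_self_add
          · exact hεR.trans (by gcongr; exact le_self_add)
      _ = (E + 1) * (R + 1) ^ (E + 1) * D ^ (E + R * (E + 1)) := by
          rw [mul_pow, ← pow_mul, pow_add]
          ring
      _ ≤ _ := mul_le_mul' le_rfl (pow_le_pow_right₀ hD (Nat.le_succ _))

end DeepMart

/-! ### Choice of the constants and conclusion for all accuracies -/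

theorem mainTheorem8
    (N : ℕ) (p pbar c q r : ℝ) (hp : 2 < p) (hpbar : 2 < pbar) (hpbar_le : pbar ≤ p)
    (hc : 0 < c) (hq : 0 < q) (hr : 0 < r)
    (k π : ℕ → ℝ) (hk1 : 1 ≤ k 1) (hπ1 : 1 ≤ π 1)
    (hk : ∀ n, 1 ≤ n → n < N → k (n + 1) = c * (1 + k n))
    (hπ : ∀ n, 1 ≤ n → n < N → π (n + 1) = π n + q) :
    ∃ C Q τ : ℕ → ℝ, (∀ n, n < N → 1 ≤ C (n + 1) ∧ 1 ≤ Q (n + 1) ∧ 1 ≤ τ (n + 1)) ∧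
      ∀ (D : ℕ), 1 ≤ D →
      ∀ (T : ℝ≥0), 0 < T →
      ∀ (Ω : Type*) (mΩ : MeasurableSpace Ω) (P : Measure Ω) (_ : IsProbabilityMeasure P)
        (𝓕 : Filtration ℝ≥0 mΩ) (x₀ : DeepMart.Vec D) (X : ℝ≥0 → Ω → DeepMart.Vec D)
        (f : ℕ → DeepMart.Vec D → Ω → DeepMart.Vec D) (g : ℝ≥0 → DeepMart.Vec D → ℝ),
      DeepMart.DynamicAssumption P 𝓕 T N x₀ X f p c q →
      DeepMart.PayoffAssumption T N g c q r →
      ∀ n, n < N → ∀ ρ : Measure (DeepMart.Vec D), IsProbabilityMeasure ρ →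
      (∫⁻ z, ‖z‖ₑ ^ pbar ∂ρ) ^ (1 / pbar) ≤
        ENNReal.ofReal (k (n + 1) * (D : ℝ) ^ π (n + 1)) →
      ∀ ε : ℝ, 0 < ε →
      ∃ Φ : DeepMart.ReLUNet D 1, 1 ≤ Φ.depth ∧
        MemLp (fun z => DeepMart.valueFn P 𝓕 T N f g (n + 1) z - Φ.toFun z) 2 ρ ∧
        eLpNorm (fun z => DeepMart.valueFn P 𝓕 T N f g (n + 1) z - Φ.toFun z) 2 ρ ≤
          ENNReal.ofReal ε ∧
        (Φ.size : ℝ) ≤ C (n + 1) * (D : ℝ) ^ Q (n + 1) * ε ^ (-τ (n + 1)) ∧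
        DeepMart.growth Φ.toFun ≤
          ENNReal.ofReal (C (n + 1) * (D : ℝ) ^ Q (n + 1) * ε ^ (-τ (n + 1))) := by
  obtain ⟨C, hC1, hC⟩ := DeepMart.exists_chain_constant N hp hc hq hr
  choose C' hC' using fun n => DeepMart.exists_moment_constant (k n) (π n)
  choose E hE using fun n (hn : n < N) =>
    DeepMart.exists_hasValueNets (N := N) (C := C) (n := n + 1) hn hC1 (C' (n + 1))
  choose R hR using fun n => DeepMart.exists_value_constant N C (C' (n + 1))
  let E' : ℕ → ℕ := fun n => if h : n < N then E n h else 0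
  -- The constants are read at `n + 1`, hence the shift `n - 1`; the default `0` of `E'` occurs only
  -- for `n ≥ N`, where nothing is claimed.
  refine ⟨fun n => (E' (n - 1) + 1) * (R (n - 1) + 1) ^ (E' (n - 1) + 1),
    fun n => (E' (n - 1) + R (n - 1) * (E' (n - 1) + 1) + 1 : ℕ), fun n => (E' (n - 1) + 1 : ℕ),
    fun n _ => ⟨?_, ?_, ?_⟩, ?_⟩
  · exact one_le_mul_of_one_le_of_one_le (by simp) (one_le_pow₀ (by simp))
  · push_cast
    exact le_add_of_nonneg_left (by positivity)
  · push_cast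
    exact le_add_of_nonneg_left (by positivity)
  intro D hD T _ Ω mΩ P _ 𝓕 x₀ X f g hX hg n hn ρ _ hρ ε hε
  obtain ⟨hchain, hpay⟩ := hC D hD T Ω mΩ P ‹_› 𝓕 x₀ X f g hX hg
  have hV : DeepMart.valueFn P 𝓕 T N f g (n + 1) =
      DeepMart.snell P f (fun m => g (DeepMart.monitorTime T N m)) N (n + 1) :=
    funext fun x => hchain.sSup_eq_snell x hn
  have hVm := hchain.measurable_snell (n := n + 1) hn
  have hM := hC' (n + 1) D hD ρ ‹_› pbar hpbar.le hρ
  simp only [Nat.add_sub_cancel]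
  rw [hV]
  have hEn : E' n = E n hn := dif_pos hn
  suffices H : ∃ Φ : DeepMart.ReLUNet D 1, 1 ≤ Φ.depth ∧
      eLpNorm (fun z => DeepMart.snell P f (fun m => g (DeepMart.monitorTime T N m)) N (n + 1) z -
        Φ.toFun z) 2 ρ ≤ ENNReal.ofReal ε ∧
      (Φ.size : ℝ) ≤ (E' n + 1) * (R n + 1) ^ (E' n + 1) *
        (D : ℝ) ^ (E' n + R n * (E' n + 1) + 1) * (ε ^ (E' n + 1))⁻¹ ∧
      DeepMart.growth Φ.toFun ≤ ENNReal.ofReal ((E' n + 1) * (R n + 1) ^ (E' n + 1) *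
        (D : ℝ) ^ (E' n + R n * (E' n + 1) + 1) * (ε ^ (E' n + 1))⁻¹) by
    obtain ⟨Φ, h1, h2, h3, h4⟩ := H
    refine ⟨Φ, h1, ⟨(hVm.sub Φ.continuous_toFun.measurable).aestronglyMeasurable,
      h2.trans_lt ENNReal.ofReal_lt_top⟩, h2, ?_, ?_⟩ <;>
    rwa [Real.rpow_neg hε.le, Real.rpow_natCast, Real.rpow_natCast]
  lift ε to ℝ≥0 using hε.le
  have hε0 : 0 < ε := by exact_mod_cast hε
  have hbound := hR n D hD Ω mΩ P 𝓕 T f g hchain (n + 1) hn ρ ‹_› hM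
  rw [ENNReal.ofReal_coe_nnreal]
  -- If `ε` exceeds the bound of the `L²(ρ)` norm of the value, the zero network suffices: its size
  -- and growth are zero, and it is given one hidden layer to meet the depth condition.
  rcases le_or_gt ((R n * D ^ R n : ℝ≥0)) ε with hlarge | hsmall
  · obtain ⟨Φ, h1, h2, h3⟩ := (DeepMart.hasNet_zero (m := D) (k := 1) 1).exists_toFun
    refine ⟨Φ, h1.ge, ?_, ?_, ?_⟩
    · simp only [h3, Pi.zero_apply, sub_zero]
      exact hbound.trans (by exact_mod_cast hlarge)
    · rw [Nat.le_zero.1 h2]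
      simp only [Nat.cast_zero]
      positivity
    · rw [DeepMart.growth_le_iff]
      intro x
      simp [h3]
  · obtain ⟨Φ, h1, h2, h3, h4⟩ := hE n hn D hD Ω mΩ P ‹_› _ f _ hchain hpay ρ ‹_› hM (min ε 1)
      (lt_min hε0 one_pos) (min_le_right _ _)
    have hle : ((E n hn : ℝ≥0) * (D / min ε 1) ^ E n hn) ≤ (E' n + 1) * (R n + 1) ^ (E' n + 1) *
        (D : ℝ≥0) ^ (E' n + R n * (E' n + 1) + 1) * (ε ^ (E' n + 1))⁻¹ := by
      rw [← hEn]
      exact DeepMart.monomial_min_le (by exact_mod_cast hD) hε0 hsmall.le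
    refine ⟨Φ, h1, h2.trans (by exact_mod_cast min_le_left _ _), ?_, h4.trans ?_⟩
    · have := h3.trans hle
      rw [← NNReal.coe_le_coe] at this
      push_cast at this
      exact this
    · rw [← ENNReal.ofReal_coe_nnreal]
      refine ENNReal.ofReal_le_ofReal ?_
      rw [← NNReal.coe_le_coe] at hle
      push_cast at hle
      exact_mod_cast hle
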